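/- Let $f:\mathbb R^2\to\mathbb R$ be given at every point by an absolutely convergent Fourier series $$f(x_1,x_2)=\sum_{(p,q)\in\mathbb Z^2}a_{pq}\,e^{2\pi i(px_1/\sqrt3+qx_2)},\qquad a_{pq}>0\ \text{ for all }(p,q)\in\mathbb Z^2,$$ so that $f$ is periodic with periods $(\sqrt3,0)$ and $(0,1)$ and basic cell $[0,\sqrt3]\times[0,1]$. Throughout, $L$ is a multiple of $3$. Put $$\tilde\epsilon_L=\frac{L^2}{2}\sum_{(p,q)\in\mathbb Z^2\setminus\{(0,0)\}}(p^2+q^2)\,a_{pL,qL}\,\bigl[1+(-1)^{p+q}\bigr].$$ Suppose that $\tilde\epsilon_L<\infty$ for all large $L$, that for some $\lambda>0$ $$\lim_{L\to\infty}e^{\lambda L}\,\frac{\tilde\epsilon_L}{a_{2L/3,L}}=0,$$ and that there are $C_0>0$ and $L_0>0$ such that for all $L>L_0$ $$\min_{|m|\le 2L/3,\ |n|\le L}a_{mn}\ \ge\ C_0\,a_{2L/3,L}.$$ For $N=2L^2$ points $X_n=(x_n,y_n)$, $1\le n\le N$, let $$E_f=\frac1{N(N-1)}\sum_{m\ne k}f(X_m-X_k),$$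 and consider only the configurations that satisfy, modulo the periods, the triplet symmetry $$X_{n+2L^2/3}=X_n+\Bigl(\tfrac{\sqrt3}{2L},\tfrac1{2L}\Bigr),\qquad X_{n+4L^2/3}=X_n+\Bigl(\tfrac{\sqrt3}{L},0\Bigr),\qquad 1\le n\le \tfrac{2L^2}{3}.$$ Then there is $L_1$ such that for every $L\ge L_1$ (with $3\mid L$) the minimizers of $E_f$ among these configurations are exactly the triangular lattice, up to translation, relabeling of the triplets and the periods: a configuration with the triplet symmetry is a minimizer if and only if, for some $t\in\mathbb R^2$, modulo the periods, $$\{X_n:1\le n\le 2L^2/3\}=t+\Bigl\{\Bigl(\tfrac{3\sqrt3(2k-1)}{4L},\tfrac{4j+1+(-1)^k}{4L}\Bigr):1\le k\le\tfrac{2L}{3},\ 1\le j\le L\Bigr\}.$$ In particular, for every minimizer the set of all $2L^2$ points is, modulo the periods, a translate of the triangular lattice consisting, for $1\le k\le L$ and $1\le j\le 2L$, of the points $\bigl(\sqrt3\,\tfrac{k-1}{L},\tfrac{j-1}{2L}\bigr)$ with $j$ odd and $\bigl(\sqrt3\,\tfrac{k-1/2}{L},\tfrac{j-1}{2L}\bigr)$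 with $j$ even. -/

import Mathlib

open Filter Topology

noncomputable section

/-- `f : ℝ² → ℝ` is everywhere the sum of the Fourier series
`∑_{(p,q) ∈ ℤ²} a_{pq} exp(2πi(p x₁/√3 + q x₂))`, so that `f` has periods `(√3, 0)` and `(0, 1)`
and Fourier coefficients `a_{pq}` on the rectangle `[0,√3] × [0,1]`. -/
def HasFourierExpansion (f : ℝ × ℝ → ℝ) (a : ℤ × ℤ → ℝ) : Prop :=
  ∀ x : ℝ × ℝ, HasSum
    (fun v : ℤ × ℤ => (a v : ℂ) * Complex.exp
      (2 * Real.pi * Complex.I * ((v.1 * x.1 / Real.sqrt 3 + v.2 * x.2 : ℝ) : ℂ)))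
    (f x : ℂ)

/-- The pair energy `E_f = (1/(N(N-1))) ∑_{m ≠ k} f(x_m - x_k)` of `N` points. -/
def pairEnergy {N : ℕ} (f : ℝ × ℝ → ℝ) (x : Fin N → ℝ × ℝ) : ℝ :=
  1 / ((N : ℝ) * ((N : ℝ) - 1)) *
    ∑ m : Fin N, ∑ k : Fin N, if m ≠ k then f (x m - x k) else 0

/-- The summand of `ε̃_L = (L²/2) ∑_{(p,q) ≠ (0,0)} (p² + q²) a_{pL,qL} [1 + (-1)^{p+q}]`;
it vanishes at `(p,q) = (0,0)`. -/
def epsTildeTerm (a : ℤ × ℤ → ℝ) (L : ℕ) (v : ℤ × ℤ) : ℝ :=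
  ((v.1 : ℝ) ^ 2 + (v.2 : ℝ) ^ 2) * a (v.1 * L, v.2 * L) * (1 + (-1 : ℝ) ^ (v.1 + v.2))

/-- `ε̃_L = (L²/2) ∑_{(p,q) ≠ (0,0)} (p² + q²) a_{pL,qL} [1 + (-1)^{p+q}]`. -/
def epsTilde (a : ℤ × ℤ → ℝ) (L : ℕ) : ℝ :=
  (L : ℝ) ^ 2 / 2 * ∑' v : ℤ × ℤ, epsTildeTerm a L v

/-- `e^{λL} ε̃_L / a_{2L/3,L} → 0` as `L = 3l → ∞`, where the series `ε̃_L` converges for all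
large `L`. -/
def ExpSmall (a : ℤ × ℤ → ℝ) (lam : ℝ) : Prop :=
  (∀ᶠ l : ℕ in atTop, Summable (epsTildeTerm a (3 * l))) ∧
  Tendsto (fun l : ℕ =>
      Real.exp (lam * ((3 * l : ℕ) : ℝ)) * (epsTilde a (3 * l) / a (2 * l, 3 * l)))
    atTop (𝓝 0)

/-- There are `C₀ > 0` and `L₀` with `min_{|m| ≤ 2L/3, |n| ≤ L} a_{mn} ≥ C₀ a_{2L/3,L}` for all
`L = 3l > L₀`. -/
def CoeffLowerBound (a : ℤ × ℤ → ℝ) : Prop :=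
  ∃ C₀ : ℝ, 0 < C₀ ∧ ∃ L₀ : ℕ, ∀ l : ℕ, L₀ < 3 * l →
    ∀ m n : ℤ, |m| ≤ 2 * l → |n| ≤ 3 * l → C₀ * a (2 * l, 3 * l) ≤ a (m, n)

/-- Two points of the plane agree modulo the periods `(√3, 0)` and `(0, 1)`. -/
def PeriodEq (u v : ℝ × ℝ) : Prop :=
  ∃ i j : ℤ, u = v + (Real.sqrt 3 * (i : ℝ), (j : ℝ))

/-- The set of all points that agree modulo the periods with a point of `S`. -/
def periodize (S : Set (ℝ × ℝ)) : Set (ℝ × ℝ) :=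
  {u | ∃ v ∈ S, PeriodEq u v}

/-- The triplet symmetry of a configuration of `2L²` points (`L` a multiple of `3`, indices
starting from `0`): for `n < 2L²/3`, modulo the periods,
`x_{n + 2L²/3} = x_n + (√3/(2L), 1/(2L))` and `x_{n + 4L²/3} = x_n + (√3/L, 0)`. -/
def IsTriplet (L : ℕ) (x : Fin (2 * L ^ 2) → ℝ × ℝ) : Prop :=
  ∀ n k : Fin (2 * L ^ 2), (n : ℕ) < 2 * L ^ 2 / 3 →
    ((k : ℕ) = (n : ℕ) + 2 * L ^ 2 / 3 →
      PeriodEq (x k) (x n + (Real.sqrt 3 / (2 * (L : ℝ)), 1 / (2 * (L : ℝ))))) ∧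
    ((k : ℕ) = (n : ℕ) + 2 * (2 * L ^ 2 / 3) →
      PeriodEq (x k) (x n + (Real.sqrt 3 / (L : ℝ), (0 : ℝ))))

/-- A minimizer of the pair energy among the configurations of `2L²` points with the triplet
symmetry. -/
def IsTripletMinimizer (f : ℝ × ℝ → ℝ) (L : ℕ) (x : Fin (2 * L ^ 2) → ℝ × ℝ) : Prop :=
  IsTriplet L x ∧ ∀ y : Fin (2 * L ^ 2) → ℝ × ℝ, IsTriplet L y → pairEnergy f x ≤ pairEnergy f y

/-- The first points `x_n`, `n < 2L²/3`, of the triplets, modulo the periods. -/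
def basePoints (L : ℕ) (x : Fin (2 * L ^ 2) → ℝ × ℝ) : Set (ℝ × ℝ) :=
  periodize {u | ∃ n : Fin (2 * L ^ 2), (n : ℕ) < 2 * L ^ 2 / 3 ∧ u = x n}

/-- The first points `(x⁰_{kj}, y⁰_{kj})`, `1 ≤ k ≤ 2L/3`, `1 ≤ j ≤ L`, of the triplets of the
triangular lattice `T_L`, modulo the periods, with `x⁰_{kj} = 3√3(2k-1)/(4L)` and
`y⁰_{kj} = (4j + 1 + (-1)^k)/(4L)`. -/
def latticeBase (L : ℕ) : Set (ℝ × ℝ) :=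
  periodize {u | ∃ k j : ℕ, (1 ≤ k ∧ k ≤ 2 * L / 3) ∧ (1 ≤ j ∧ j ≤ L) ∧
    u = (3 * Real.sqrt 3 * (2 * (k : ℝ) - 1) / (4 * (L : ℝ)),
      (4 * (j : ℝ) + (1 + (-1 : ℝ) ^ k)) / (4 * (L : ℝ)))}

/-- The triangular lattice of `2L²` points in the rectangle, modulo the periods: for `1 ≤ k ≤ L`
and `1 ≤ j ≤ 2L` the points `(√3(k-1)/L, (j-1)/(2L))` with `j` odd and
`(√3(k-1/2)/L, (j-1)/(2L))` with `j` even. -/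
def triangularLattice (L : ℕ) : Set (ℝ × ℝ) :=
  periodize {u | ∃ k j : ℕ, (1 ≤ k ∧ k ≤ L) ∧ (1 ≤ j ∧ j ≤ 2 * L) ∧
    ((Odd j ∧ u = (Real.sqrt 3 * ((k : ℝ) - 1) / (L : ℝ), ((j : ℝ) - 1) / (2 * (L : ℝ)))) ∨
     (Even j ∧ u = (Real.sqrt 3 * ((k : ℝ) - 1 / 2) / (L : ℝ), ((j : ℝ) - 1) / (2 * (L : ℝ)))))}

/-- The translate `t + S`. -/
def translateSet (t : ℝ × ℝ) (S : Set (ℝ × ℝ)) : Set (ℝ × ℝ) :=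
  (fun u => t + u) '' S

end

/-! Write `L = 3l` and `M = 6l²`, the number of triplets. By the triplet symmetry the exponential
sum of the configuration at `v` is `T(v) S(v)`, with `T` the `tripletFactor` and `S` the sum over
the first points. The energy is thus, up to an increasing affine change, `∑ a_v |T(v)|² |S(v)|²`.
For the base lattice, `S` lives on the reciprocal lattice spanned by `(2l, 0)` and `(l, 3l)`, and
`T` kills all of it except `(pL, qL)` with `p + q` even. There `|S| ≤ M` for every configuration, so
a competitor can beat the lattice only at frequencies outside the box `|p| ≤ 2l`, `|q| ≤ 3l`, and
there it cannot gain at all.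

What must be bounded is what the lattice loses by reaching `|S| = M` at these frequencies. Let `D`
be the sum of `|S|²` over the nonzero frequencies of the box with `T ≠ 0`. The deficit `M² - |S(pL,
qL)|²` is at most `20 (p² + q²) M² D`. For this, take the `M` frequencies of a `2l × 3l` cell and
their trigonometric polynomial. Its squared moduli over all pairs of points sum to at most `M³ + M²
D`, and the pairs `m = k` already account for `M³`, so little remains for distinct pairs
(`sum_sum_norm_sum_planeWave_le`). Trading the frequency `0` for a generator `w` of the reciprocal
lattice keeps the bound, and subtracting the two polynomials shows that `w · (X_m - X_k)` is nearly
an integer (`sum_sum_norm_planeWave_sub_one_le`). Integer combinations of the generators inherit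
this.

On the other side, a nonzero `T` is at least of order `l⁻²`, because it is a sum of three roots of
unity of order dividing `6l` (`one_div_le_norm_one_add_add`). Hence the energy exceeds that of the
lattice by at least `D` times (box coefficient times `l⁻⁴`, minus a multiple of `l² ε̃`)
(`energy_sub_ge`), and exponential smallness makes this factor positive. So lattices are minimizers,
and every minimizer has `D = 0`. Then all phases are exactly integral and the points are distinct
modulo the periods, which forces the base lattice. -/

/-! ### Plane waves on the rectangle -/

/-- The Fourier mode of frequency `v` of the rectangle `[0,√3] × [0,1]`. -/
noncomputable def planeWave (v : ℤ × ℤ) (x : ℝ × ℝ) : ℂ :=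
  Complex.exp (2 * Real.pi * Complex.I * ((v.1 * x.1 / Real.sqrt 3 + v.2 * x.2 : ℝ) : ℂ))

lemma norm_planeWave (v : ℤ × ℤ) (x : ℝ × ℝ) : ‖planeWave v x‖ = 1 := by
  rw [planeWave, show 2 * Real.pi * Complex.I * ((v.1 * x.1 / Real.sqrt 3 + v.2 * x.2 : ℝ) : ℂ)
    = ((2 * Real.pi * (v.1 * x.1 / Real.sqrt 3 + v.2 * x.2) : ℝ) : ℂ) * Complex.I by
      push_cast; ring]
  exact Complex.norm_exp_ofReal_mul_I _

lemma planeWave_add (v : ℤ × ℤ) (x y : ℝ × ℝ) :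
    planeWave v (x + y) = planeWave v x * planeWave v y := by
  simp only [planeWave, ← Complex.exp_add, Prod.fst_add, Prod.snd_add]
  congr 1
  push_cast
  ring

lemma planeWave_add_left (v w : ℤ × ℤ) (x : ℝ × ℝ) :
    planeWave (v + w) x = planeWave v x * planeWave w x := by
  simp only [planeWave, ← Complex.exp_add, Prod.fst_add, Prod.snd_add]
  congr 1
  push_cast
  ring

@[simp] lemma planeWave_zero_left (x : ℝ × ℝ) : planeWave 0 x = 1 := by simp [planeWave]

@[simp] lemma planeWave_zero (v : ℤ × ℤ) : planeWave v 0 = 1 := by simp [planeWave]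

lemma planeWave_neg (v : ℤ × ℤ) (x : ℝ × ℝ) :
    planeWave v (-x) = (starRingEnd ℂ) (planeWave v x) := by
  simp only [planeWave, ← Complex.exp_conj, map_mul, Complex.conj_I, Complex.conj_ofReal,
    Prod.fst_neg, Prod.snd_neg]
  congr 1
  rw [show (starRingEnd ℂ) 2 = 2 from Complex.conj_ofReal 2]
  push_cast
  ring

lemma planeWave_neg_left (v : ℤ × ℤ) (x : ℝ × ℝ) :
    planeWave (-v) x = (starRingEnd ℂ) (planeWave v x) := by
  rw [← planeWave_neg]
  simp only [planeWave, Prod.fst_neg, Prod.snd_neg]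
  congr 1
  push_cast
  ring

lemma planeWave_sub (v : ℤ × ℤ) (x y : ℝ × ℝ) :
    planeWave v (x - y) = planeWave v x * (starRingEnd ℂ) (planeWave v y) := by
  rw [sub_eq_add_neg, planeWave_add, planeWave_neg]

lemma planeWave_sub_left (v w : ℤ × ℤ) (x : ℝ × ℝ) :
    planeWave (v - w) x = planeWave v x * (starRingEnd ℂ) (planeWave w x) := by
  rw [sub_eq_add_neg, planeWave_add_left, planeWave_neg_left]

lemma planeWave_zsmul_left (i : ℤ) (v : ℤ × ℤ) (x : ℝ × ℝ) :
    planeWave (i • v) x = planeWave v x ^ i := by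
  simp only [planeWave, ← Complex.exp_int_mul, Prod.smul_fst, Prod.smul_snd, smul_eq_mul]
  congr 1
  push_cast
  ring

lemma planeWave_eq_one_iff (v : ℤ × ℤ) (x : ℝ × ℝ) :
    planeWave v x = 1 ↔ ∃ n : ℤ, v.1 * x.1 / Real.sqrt 3 + v.2 * x.2 = n := by
  rw [planeWave, Complex.exp_eq_one_iff]
  refine exists_congr fun n => ?_
  rw [mul_comm (n : ℂ), mul_right_inj' Complex.two_pi_I_ne_zero]
  norm_cast

lemma planeWave_congr {u w : ℝ × ℝ} (h : PeriodEq u w) (v : ℤ × ℤ) :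
    planeWave v u = planeWave v w := by
  obtain ⟨i, j, rfl⟩ := h
  have : Real.sqrt 3 ≠ 0 := by positivity
  have h : planeWave v (Real.sqrt 3 * (i : ℝ), (j : ℝ)) = 1 := by
    rw [planeWave_eq_one_iff]
    refine ⟨v.1 * i + v.2 * j, ?_⟩
    push_cast
    field_simp
  rw [planeWave_add, h, mul_one]

/-! ### Exponential sums and sums over pairs of points -/

/-- The exponential sum `∑ₙ exp(2πi v·xₙ)` of a finite configuration. -/
noncomputable def expSum {ι : Type*} [Fintype ι] (X : ι → ℝ × ℝ) (v : ℤ × ℤ) : ℂ :=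
  ∑ n, planeWave v (X n)

section ExpSum

variable {ι : Type*} [Fintype ι]

lemma sum_sum_planeWave_sub (X : ι → ℝ × ℝ) (v : ℤ × ℤ) :
    ∑ m, ∑ k, planeWave v (X m - X k) = ((‖expSum X v‖ ^ 2 : ℝ) : ℂ) := by
  push_cast
  rw [← Complex.mul_conj', expSum, map_sum, Finset.sum_mul_sum]
  simp only [planeWave_sub]

lemma norm_expSum_le (X : ι → ℝ × ℝ) (v : ℤ × ℤ) : ‖expSum X v‖ ≤ Fintype.card ι := by
  refine (norm_sum_le _ _).trans ?_
  simp [norm_planeWave]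

lemma expSum_zero (X : ι → ℝ × ℝ) : expSum X 0 = Fintype.card ι := by simp [expSum]

/-- The sum keeps the diagonal `m = k`, which is what turns each mode into a square; the diagonal is
a constant and is removed in `pairEnergy_eq`. -/
lemma hasSum_energy {f : ℝ × ℝ → ℝ} {a : ℤ × ℤ → ℝ} (hf : HasFourierExpansion f a)
    (X : ι → ℝ × ℝ) :
    HasSum (fun v => a v * ‖expSum X v‖ ^ 2) (∑ m, ∑ k, f (X m - X k)) := by
  have h : HasSum (fun v => ∑ m, ∑ k, (a v : ℂ) * planeWave v (X m - X k))
      (∑ m, ∑ k, (f (X m - X k) : ℂ)) :=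
    hasSum_sum fun m _ => hasSum_sum fun k _ => hf (X m - X k)
  rw [← Complex.hasSum_ofReal]
  convert h using 1
  · funext v
    simp only [← Finset.mul_sum, sum_sum_planeWave_sub]
    push_cast
    rfl
  · push_cast
    rfl

/-- On the unit circle `|z - 1|² = 2 - 2 Re z`. This converts between integrality of phases and
nearness of `|S|` to its maximum. -/
lemma sum_sum_norm_planeWave_sub_one (X : ι → ℝ × ℝ) (v : ℤ × ℤ) :
    ∑ m, ∑ k, ‖planeWave v (X m - X k) - 1‖ ^ 2
      = 2 * ((Fintype.card ι : ℝ) ^ 2 - ‖expSum X v‖ ^ 2) := by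
  have h (x : ℝ × ℝ) : ‖planeWave v x - 1‖ ^ 2 = 2 - 2 * (planeWave v x).re := by
    have := norm_planeWave v x
    rw [← Complex.normSq_eq_norm_sq, Complex.normSq_sub, Complex.normSq_eq_norm_sq, this]
    simp
    ring
  have h2 := congrArg Complex.re (sum_sum_planeWave_sub X v)
  simp only [Complex.re_sum, Complex.ofReal_re] at h2
  simp only [h, Finset.sum_sub_distrib, ← Finset.mul_sum, h2]
  simp
  ring

/-- The trigonometric polynomial with frequencies `A` satisfies a Parseval-type identity over all
pairs of a configuration. -/
lemma sum_sum_norm_sum_planeWave (X : ι → ℝ × ℝ) (A : Finset (ℤ × ℤ)) :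
    ∑ m, ∑ k, ‖∑ v ∈ A, planeWave v (X m - X k)‖ ^ 2
      = ∑ v ∈ A, ∑ w ∈ A, ‖expSum X (v - w)‖ ^ 2 := by
  rw [← Complex.ofReal_inj]
  push_cast
  simp only [← Complex.mul_conj', map_sum, Finset.sum_mul_sum, ← planeWave_sub_left]
  rw [Finset.sum_congr rfl fun m _ => Finset.sum_comm]
  rw [Finset.sum_comm]
  refine Finset.sum_congr rfl fun v _ => ?_
  rw [Finset.sum_congr rfl fun m _ => Finset.sum_comm, Finset.sum_comm]
  refine Finset.sum_congr rfl fun w _ => ?_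
  have := sum_sum_planeWave_sub X (v - w)
  push_cast at this
  rw [this, Complex.mul_conj']

/-- Both sides of the Parseval identity have a diagonal. The pairs `m = k` give `M · |A|²` and the
pairs `v = w` give `|A| · M²`; these cancel exactly because `|A| = M`, leaving only the off-diagonal
terms, which `D` bounds. -/
lemma sum_sum_norm_sum_planeWave_le [DecidableEq ι] (X : ι → ℝ × ℝ) {A : Finset (ℤ × ℤ)}
    (hA : A.card = Fintype.card ι) {D : ℝ} (hD : 0 ≤ D)
    (h : ∀ v ∈ A, ∀ w ∈ A, v ≠ w → ‖expSum X (v - w)‖ ^ 2 ≤ D) :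
    ∑ m, ∑ k, (if m = k then 0 else ‖∑ v ∈ A, planeWave v (X m - X k)‖ ^ 2)
      ≤ (Fintype.card ι : ℝ) ^ 2 * D := by
  set M : ℝ := (Fintype.card ι : ℝ)
  have hl : ∑ m, ∑ k, ‖∑ v ∈ A, planeWave v (X m - X k)‖ ^ 2 = M * M ^ 2 +
      ∑ m, ∑ k, (if m = k then 0 else ‖∑ v ∈ A, planeWave v (X m - X k)‖ ^ 2) := by
    have (m k : ι) : ‖∑ v ∈ A, planeWave v (X m - X k)‖ ^ 2 = (if m = k then M ^ 2 else 0) +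
        (if m = k then 0 else ‖∑ v ∈ A, planeWave v (X m - X k)‖ ^ 2) := by
      split_ifs with hmk
      · subst hmk
        simp [hA, M]
      · simp
    rw [Finset.sum_congr rfl fun m _ => Finset.sum_congr rfl fun k _ => this m k]
    simp [Finset.sum_add_distrib, M]
  have hr : ∑ v ∈ A, ∑ w ∈ A, ‖expSum X (v - w)‖ ^ 2 ≤ M * M ^ 2 + M ^ 2 * D := by
    have : ∀ v ∈ A, ∀ w ∈ A, ‖expSum X (v - w)‖ ^ 2 ≤ (if v = w then M ^ 2 else 0) + D := by
      intro v hv w hw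
      split_ifs with hvw
      · subst hvw
        simp [expSum_zero, M, hD]
      · simpa using h v hv w hw hvw
    refine (Finset.sum_le_sum fun v hv => Finset.sum_le_sum (this v hv)).trans (le_of_eq ?_)
    simp [Finset.sum_add_distrib, hA, M]
    ring
  rw [sum_sum_norm_sum_planeWave] at hl
  linarith

/-- If `A` and `(A \ {0}) ∪ {w}` both have exponential sums bounded on their nonzero differences,
then all pairs have almost integral phase with respect to `w`. -/
lemma sum_sum_norm_planeWave_sub_one_le [DecidableEq ι] (X : ι → ℝ × ℝ) {A : Finset (ℤ × ℤ)}
    {w : ℤ × ℤ} (h0 : (0 : ℤ × ℤ) ∈ A) (hw : w ∉ A) (hA : A.card = Fintype.card ι) {D : ℝ}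
    (hD : 0 ≤ D) (h : ∀ u ∈ A, ∀ v ∈ A, u ≠ v → ‖expSum X (u - v)‖ ^ 2 ≤ D)
    (hw' : ∀ u ∈ A, u ≠ 0 → ‖expSum X (w - u)‖ ^ 2 ≤ D) :
    ∑ m, ∑ k, ‖planeWave w (X m - X k) - 1‖ ^ 2 ≤ 4 * (Fintype.card ι : ℝ) ^ 2 * D := by
  have hwe : w ∉ A.erase 0 := fun h => hw (Finset.mem_of_mem_erase h)
  have hcard : (insert w (A.erase 0)).card = Fintype.card ι := by
    rw [Finset.card_insert_of_notMem hwe, Finset.card_erase_add_one h0, hA]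
  have hneg (v : ℤ × ℤ) : ‖expSum X (-v)‖ = ‖expSum X v‖ := by
    simp only [expSum, planeWave_neg_left, ← map_sum, Complex.norm_conj]
  have h' : ∀ u ∈ insert w (A.erase 0), ∀ v ∈ insert w (A.erase 0), u ≠ v →
      ‖expSum X (u - v)‖ ^ 2 ≤ D := by
    intro u hu v hv huv
    rw [Finset.mem_insert, Finset.mem_erase] at hu hv
    rcases hu with rfl | ⟨hu0, hu⟩ <;> rcases hv with rfl | ⟨hv0, hv⟩
    · exact absurd rfl huv
    · exact hw' v hv hv0
    · rw [← hneg, neg_sub]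
      exact hw' u hu hu0
    · exact h u hu v hv huv
  have b1 := sum_sum_norm_sum_planeWave_le X hA hD h
  have b2 := sum_sum_norm_sum_planeWave_le X hcard hD h'
  have key (m k : ι) : ‖planeWave w (X m - X k) - 1‖ ^ 2
      ≤ 2 * (if m = k then 0 else ‖∑ v ∈ A, planeWave v (X m - X k)‖ ^ 2) +
        2 * (if m = k then 0 else ‖∑ v ∈ insert w (A.erase 0), planeWave v (X m - X k)‖ ^ 2) := by
    split_ifs with hmk
    · simp [hmk]
    -- The two polynomials share all frequencies except `w` and `0`, so their difference is the
    -- phase defect of `w`.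
    · have e1 : planeWave w (X m - X k) - 1 = ∑ v ∈ insert w (A.erase 0), planeWave v (X m - X k)
          - ∑ v ∈ A, planeWave v (X m - X k) := by
        rw [Finset.sum_insert hwe, ← Finset.add_sum_erase A _ h0, planeWave_zero_left]
        ring
      rw [e1]
      have := norm_sub_le (∑ v ∈ insert w (A.erase 0), planeWave v (X m - X k))
        (∑ v ∈ A, planeWave v (X m - X k))
      nlinarith [norm_nonneg (∑ v ∈ insert w (A.erase 0), planeWave v (X m - X k)
          - ∑ v ∈ A, planeWave v (X m - X k)),
        sq_nonneg (‖∑ v ∈ insert w (A.erase 0), planeWave v (X m - X k)‖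
          - ‖∑ v ∈ A, planeWave v (X m - X k)‖)]
  refine (Finset.sum_le_sum fun m _ => Finset.sum_le_sum fun k _ => key m k).trans ?_
  simp only [Finset.sum_add_distrib, ← Finset.mul_sum]
  linarith

lemma norm_zpow_sub_one_le {z : ℂ} (hz : ‖z‖ = 1) (i : ℤ) : ‖z ^ i - 1‖ ≤ |(i : ℝ)| * ‖z - 1‖ := by
  have hn (n : ℕ) : ‖z ^ n - 1‖ ≤ n * ‖z - 1‖ := by
    induction n with
    | zero => simp
    | succ n ih =>
      have : z ^ (n + 1) - 1 = z ^ n * (z - 1) + (z ^ n - 1) := by ring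
      rw [this]
      refine (norm_add_le _ _).trans ?_
      rw [norm_mul, norm_pow, hz, one_pow]
      push_cast
      linarith
  obtain ⟨n, rfl | rfl⟩ := i.eq_nat_or_neg
  · simpa using hn n
  · have hz0 : z ^ n ≠ 0 := pow_ne_zero _ (norm_ne_zero_iff.1 (by simp [hz]))
    have : z ^ (-(n : ℤ)) - 1 = -(z ^ n)⁻¹ * (z ^ n - 1) := by
      rw [zpow_neg, zpow_natCast]
      field_simp
      ring
    rw [this, norm_mul, norm_neg, norm_inv, norm_pow, hz]
    simpa using hn n

/-- Phase defects grow at most linearly under integer powers and add under products. The factor 2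
lost in squaring a sum of two terms is the 2 in `sum_sum_norm_planeWave_sub_one`. -/
lemma card_sq_sub_norm_expSum_sq_le (X : ι → ℝ × ℝ) {w₁ w₂ : ℤ × ℤ} {K : ℝ}
    (h₁ : ∑ m, ∑ k, ‖planeWave w₁ (X m - X k) - 1‖ ^ 2 ≤ K)
    (h₂ : ∑ m, ∑ k, ‖planeWave w₂ (X m - X k) - 1‖ ^ 2 ≤ K) (i j : ℤ) :
    (Fintype.card ι : ℝ) ^ 2 - ‖expSum X (i • w₁ + j • w₂)‖ ^ 2
      ≤ ((i : ℝ) ^ 2 + (j : ℝ) ^ 2) * K := by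
  have key (x : ℝ × ℝ) : ‖planeWave (i • w₁ + j • w₂) x - 1‖ ^ 2
      ≤ 2 * (i : ℝ) ^ 2 * ‖planeWave w₁ x - 1‖ ^ 2 + 2 * (j : ℝ) ^ 2 * ‖planeWave w₂ x - 1‖ ^ 2 := by
    rw [planeWave_add_left, planeWave_zsmul_left, planeWave_zsmul_left]
    set z := planeWave w₁ x
    set w := planeWave w₂ x
    have hz : ‖z‖ = 1 := norm_planeWave _ _
    have hw : ‖w‖ = 1 := norm_planeWave _ _
    have e : z ^ i * w ^ j - 1 = z ^ i * (w ^ j - 1) + (z ^ i - 1) := by ring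
    have h3 : ‖z ^ i * w ^ j - 1‖ ≤ |(j : ℝ)| * ‖w - 1‖ + |(i : ℝ)| * ‖z - 1‖ := by
      rw [e]
      refine (norm_add_le _ _).trans (add_le_add ?_ (norm_zpow_sub_one_le hz i))
      rw [norm_mul, norm_zpow, hz, one_zpow, one_mul]
      exact norm_zpow_sub_one_le hw j
    refine (pow_le_pow_left₀ (norm_nonneg _) h3 2).trans ?_
    rw [← sq_abs (i : ℝ), ← sq_abs (j : ℝ)]
    nlinarith [sq_nonneg (|(j : ℝ)| * ‖w - 1‖ - |(i : ℝ)| * ‖z - 1‖)]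
  have := (Finset.sum_le_sum fun m (_ : m ∈ Finset.univ) =>
    Finset.sum_le_sum fun k (_ : k ∈ Finset.univ) => key (X m - X k))
  rw [sum_sum_norm_planeWave_sub_one] at this
  simp only [Finset.sum_add_distrib, ← Finset.mul_sum] at this
  have := mul_le_mul_of_nonneg_left h₁ (sq_nonneg (i : ℝ))
  have := mul_le_mul_of_nonneg_left h₂ (sq_nonneg (j : ℝ))
  linarith

end ExpSum

/-! ### Lower bounds for sums of three roots of unity -/

/-- Since `∑ z ^ k = 0`, one has `n = ∑ (1 - z ^ k)`, and each term has modulus at most `n ‖1 - z‖`.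
-/
lemma one_div_le_norm_one_sub_of_pow_eq_one {z : ℂ} {n : ℕ} (hn : 0 < n) (hz : z ^ n = 1)
    (h1 : z ≠ 1) : 1 / (n : ℝ) ≤ ‖1 - z‖ := by
  have hnorm : ‖z‖ = 1 := Complex.norm_eq_one_of_pow_eq_one hz hn.ne'
  have hsum : ∑ k ∈ Finset.range n, z ^ k = 0 := by
    have := mul_geom_sum z n
    rw [hz, sub_self, mul_eq_zero] at this
    exact this.resolve_left (sub_ne_zero.2 h1)
  have h2 : (n : ℂ) = ∑ k ∈ Finset.range n, (1 - z ^ k) := by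
    simp [Finset.sum_sub_distrib, hsum]
  have h3 : (n : ℝ) ≤ n * (n * ‖1 - z‖) := by
    calc (n : ℝ) = ‖(n : ℂ)‖ := by simp
      _ ≤ ∑ k ∈ Finset.range n, ‖1 - z ^ k‖ := by rw [h2]; exact norm_sum_le _ _
      _ ≤ ∑ k ∈ Finset.range n, n * ‖1 - z‖ := by
        refine Finset.sum_le_sum fun k hk => ?_
        have := norm_zpow_sub_one_le hnorm k
        rw [norm_sub_rev, norm_sub_rev 1 z]
        refine le_trans (by simpa using this) ?_
        gcongr
        exact (Finset.mem_range.1 hk).le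
      _ = n * (n * ‖1 - z‖) := by simp
  have hn' : (0 : ℝ) < n := by exact_mod_cast hn
  rw [div_le_iff₀ hn']
  nlinarith

/-- The polynomial factors over the primitive cube roots of unity, and as `3 ∣ n` the quotient of
`u` by such a root is again an `n`-th root of unity, so each factor is at least `1 / n`. -/
lemma one_div_sq_le_norm_of_pow_eq_one {u : ℂ} {n : ℕ} (hn : 0 < n) (h3 : 3 ∣ n) (hu : u ^ n = 1)
    (h : u ^ 2 + u + 1 ≠ 0) : 1 / (n : ℝ) ^ 2 ≤ ‖u ^ 2 + u + 1‖ := by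
  set w : ℂ := Complex.exp (2 * Real.pi * Complex.I / 3) with hw
  have hprim : IsPrimitiveRoot w 3 := Complex.isPrimitiveRoot_exp 3 (by norm_num)
  have hw3 : w ^ 3 = 1 := hprim.pow_eq_one
  have hw1 : w ≠ 1 := hprim.ne_one (by norm_num)
  have hw0 : w ≠ 0 := Complex.exp_ne_zero _
  have hw2 : w ^ 2 + w + 1 = 0 := by
    have : (w - 1) * (w ^ 2 + w + 1) = 0 := by linear_combination hw3
    exact (mul_eq_zero.1 this).resolve_left (sub_ne_zero.2 hw1)
  have hwn : ‖w‖ = 1 := Complex.norm_eq_one_of_pow_eq_one hw3 (by norm_num)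
  have hfac : u ^ 2 + u + 1 = (u - w) * (u - w ^ 2) := by
    linear_combination (u) * hw2 - hw3
  have key (t : ℂ) (ht3 : t ^ 3 = 1) (hut : u - t ≠ 0) : 1 / (n : ℝ) ≤ ‖u - t‖ := by
    have ht0 : t ≠ 0 := fun h => by simp [h] at ht3
    have htn : ‖t‖ = 1 := Complex.norm_eq_one_of_pow_eq_one ht3 (by norm_num)
    have e : ‖u - t‖ = ‖1 - u / t‖ := by
      rw [norm_sub_rev, show t - u = t * (1 - u / t) by field_simp, norm_mul, htn, one_mul]
    rw [e]
    refine one_div_le_norm_one_sub_of_pow_eq_one hn ?_ ?_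
    · obtain ⟨k, rfl⟩ := h3
      rw [div_pow, hu, pow_mul t, ht3, one_pow, div_one]
    · rw [Ne, div_eq_one_iff_eq ht0]
      exact fun h => hut (sub_eq_zero.2 h)
  rw [hfac] at h ⊢
  have h1 := key w hw3 (left_ne_zero_of_mul h)
  have h2 := key (w ^ 2) (by rw [← pow_mul, mul_comm, pow_mul, hw3, one_pow])
    (right_ne_zero_of_mul h)
  rw [norm_mul, sq, ← one_div_mul_one_div]
  exact mul_le_mul h1 h2 (by positivity) (norm_nonneg _)

/-- Eliminates `w`: expanding `|T - (1 + u)|² = 1` with `T = 1 + u + w` expresses `u ^ 2 + u + 1`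
through terms that each contain `T` or its conjugate. The constant is `7 = 2 + 2 + 3`, from `|1 + u|
≤ 2` twice and `|T| ≤ 3`. -/
lemma norm_sq_add_add_one_le {u w : ℂ} (hu : ‖u‖ = 1) (hw : ‖w‖ = 1) :
    ‖u ^ 2 + u + 1‖ ≤ 7 * ‖1 + u + w‖ := by
  set T := 1 + u + w with hT
  have cu : u * (starRingEnd ℂ) u = 1 := by rw [Complex.mul_conj', hu]; simp
  have cw : w * (starRingEnd ℂ) w = 1 := by rw [Complex.mul_conj', hw]; simp
  have e : u ^ 2 + u + 1 = u * (T * (1 + (starRingEnd ℂ) u) + (starRingEnd ℂ) T * (1 + u)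
      - T * (starRingEnd ℂ) T) := by
    simp only [hT, map_add, map_one]
    linear_combination u * cw - (1 + u) * cu
  have hT3 : ‖T‖ ≤ 3 := by
    refine (norm_add_le _ _).trans ?_
    have := norm_add_le 1 u
    rw [norm_one, hu] at this
    linarith
  have h1 : ‖1 + u‖ ≤ 2 := by
    have := norm_add_le 1 u
    rw [norm_one, hu] at this
    linarith
  have h2 : ‖1 + (starRingEnd ℂ) u‖ ≤ 2 := by
    have := norm_add_le 1 ((starRingEnd ℂ) u)
    rw [norm_one, Complex.norm_conj, hu] at this
    linarith
  rw [e, norm_mul, hu, one_mul]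
  refine (norm_sub_le _ _).trans ?_
  have h3 := norm_add_le (T * (1 + (starRingEnd ℂ) u)) ((starRingEnd ℂ) T * (1 + u))
  simp only [norm_mul, Complex.norm_conj] at h3 ⊢
  nlinarith [norm_nonneg T]

/-- If `u` or `w` is not a primitive cube root of unity, the two preceding bounds combine. If both
are, either they are the two different ones, excluded by `h`, or they coincide and the sum has
modulus `√3`. -/
lemma one_div_le_norm_one_add_add {u w : ℂ} {n : ℕ} (hn : 0 < n) (h3 : 3 ∣ n) (hu : u ^ n = 1)
    (hw : w ^ n = 1) (h : 1 + u + w ≠ 0) : 1 / (7 * (n : ℝ) ^ 2) ≤ ‖1 + u + w‖ := by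
  have hun : ‖u‖ = 1 := Complex.norm_eq_one_of_pow_eq_one hu hn.ne'
  have hwn : ‖w‖ = 1 := Complex.norm_eq_one_of_pow_eq_one hw hn.ne'
  have hn2 : (0 : ℝ) < (n : ℝ) ^ 2 := by positivity
  have aux {t : ℝ} (ht : 1 / (n : ℝ) ^ 2 ≤ 7 * t) : 1 / (7 * (n : ℝ) ^ 2) ≤ t := by
    rw [div_le_iff₀ hn2] at ht
    rw [div_le_iff₀ (by positivity)]
    linarith
  by_cases hu2 : u ^ 2 + u + 1 = 0
  · by_cases hw2 : w ^ 2 + w + 1 = 0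
    · have huw : (w - u) * (1 + u + w) = 0 := by linear_combination hw2 - hu2
      obtain rfl : w = u := sub_eq_zero.1 ((mul_eq_zero.1 huw).resolve_right h)
      have hsq : ‖1 + w + w‖ ^ 2 = 3 := by
        rw [← norm_pow, show (1 + w + w) ^ 2 = -3 by linear_combination 4 * hu2]
        simp
      have h1 : 1 ≤ ‖1 + w + w‖ := by nlinarith [norm_nonneg (1 + w + w)]
      refine le_trans ?_ h1
      rw [div_le_one (by positivity)]
      have : (1 : ℝ) ≤ n := by exact_mod_cast hn
      nlinarith
    · have := norm_sq_add_add_one_le hwn hun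
      rw [show 1 + w + u = 1 + u + w by ring] at this
      exact aux ((one_div_sq_le_norm_of_pow_eq_one hn h3 hw hw2).trans this)
  · exact aux ((one_div_sq_le_norm_of_pow_eq_one hn h3 hu hu2).trans (norm_sq_add_add_one_le hun hwn))

/-! ### The triplet factor and its zeros -/

/-- The exponential sum of a triplet `0`, `(√3/(6l), 1/(6l))`, `(√3/(3l), 0)`. -/
noncomputable def tripletFactor (l : ℕ) (v : ℤ × ℤ) : ℂ :=
  1 + planeWave v (Real.sqrt 3 / (2 * ((3 * l : ℕ) : ℝ)), 1 / (2 * ((3 * l : ℕ) : ℝ)))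
    + planeWave v (Real.sqrt 3 / ((3 * l : ℕ) : ℝ), 0)

section TripletFactor

variable {l : ℕ}

/-- Both waves are roots of unity of order dividing `n = 6l`, and `252 = 7 · 6²`. -/
lemma norm_tripletFactor_ge (hl : 0 < l) {v : ℤ × ℤ} (h : tripletFactor l v ≠ 0) :
    1 / (252 * (l : ℝ) ^ 2) ≤ ‖tripletFactor l v‖ := by
  have hl' : (l : ℝ) ≠ 0 := by exact_mod_cast hl.ne'
  have hs : Real.sqrt 3 ≠ 0 := by positivity
  have := one_div_le_norm_one_add_add (n := 6 * l) (by omega) ⟨2 * l, by ring⟩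
    (u := planeWave v (Real.sqrt 3 / (2 * ((3 * l : ℕ) : ℝ)), 1 / (2 * ((3 * l : ℕ) : ℝ))))
    (w := planeWave v (Real.sqrt 3 / ((3 * l : ℕ) : ℝ), 0)) ?_ ?_ h
  · refine le_trans (le_of_eq ?_) this
    push_cast
    ring
  · rw [← zpow_natCast, ← planeWave_zsmul_left, planeWave_eq_one_iff]
    refine ⟨v.1 + v.2, ?_⟩
    simp
    field_simp
    ring
  · rw [← zpow_natCast, ← planeWave_zsmul_left, planeWave_eq_one_iff]
    refine ⟨2 * v.1, ?_⟩
    simp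
    field_simp
    ring

/-- Three unit vectors sum to zero only as `1, u, u²` with `u` a primitive cube root of unity. The
phase of `u` is `(p + q) / (6l)`, and `w = u²` says that `q / (3l)` is an integer. -/
lemma dvd_of_tripletFactor_eq_zero (hl : 0 < l) {v : ℤ × ℤ} (h : tripletFactor l v = 0) :
    (∃ k : ℤ, v.1 + v.2 = 2 * l * k ∧ k ≠ 0) ∧ ∃ s : ℤ, v.2 = 3 * l * s := by
  have hl' : (l : ℝ) ≠ 0 := by exact_mod_cast hl.ne'
  have hs : Real.sqrt 3 ≠ 0 := by positivity
  have hn := norm_sq_add_add_one_le (norm_planeWave v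
    (Real.sqrt 3 / (2 * ((3 * l : ℕ) : ℝ)), 1 / (2 * ((3 * l : ℕ) : ℝ))))
    (norm_planeWave v (Real.sqrt 3 / ((3 * l : ℕ) : ℝ), 0))
  rw [tripletFactor] at h
  rw [h, norm_zero, mul_zero, norm_le_zero_iff] at hn
  set x : ℝ × ℝ := (Real.sqrt 3 / (2 * ((3 * l : ℕ) : ℝ)), 1 / (2 * ((3 * l : ℕ) : ℝ))) with hx
  set y : ℝ × ℝ := (Real.sqrt 3 / ((3 * l : ℕ) : ℝ), 0) with hy
  have h3 : planeWave ((3 : ℤ) • v) x = 1 := by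
    rw [planeWave_zsmul_left]
    have : planeWave v x ^ 3 = 1 := by linear_combination (planeWave v x - 1) * hn
    exact_mod_cast this
  -- The vector `x + x - y` is the vertical step `(0, 1/(3l))`, so this isolates `v.2`.
  have h2 : planeWave v (x + x - y) = 1 := by
    have e : planeWave v y = planeWave v x * planeWave v x := by linear_combination h - hn
    rw [planeWave_sub, planeWave_add, ← e, Complex.mul_conj', norm_planeWave]
    simp
  rw [planeWave_eq_one_iff] at h3 h2
  obtain ⟨k, hk⟩ := h3
  obtain ⟨s, hs'⟩ := h2
  simp only [hx, hy, Prod.smul_fst, Prod.smul_snd, Prod.fst_add, Prod.snd_add, Prod.fst_sub,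
    Prod.snd_sub, smul_eq_mul] at hk hs'
  push_cast at hk hs'
  field_simp at hk hs'
  refine ⟨⟨k, ?_, ?_⟩, s, ?_⟩
  · have : (v.1 + v.2 : ℝ) = 2 * l * k := by linarith
    exact_mod_cast this
  · rintro rfl
    have h1 : planeWave v x = 1 := by
      rw [planeWave_eq_one_iff]
      refine ⟨0, ?_⟩
      simp only [hx]
      push_cast at hk ⊢
      field_simp
      linarith
    rw [h1] at hn
    norm_num at hn
  · have : (v.2 : ℝ) = 3 * l * s := by linarith
    exact_mod_cast this

/-- The zeros of the triplet factor with `|p| ≤ 2l`, `|q| ≤ 3l` are the vertices of a hexagon. -/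
lemma tripletFactor_eq_zero_of_mem_box (hl : 0 < l) {v : ℤ × ℤ} (h : tripletFactor l v = 0)
    (h1 : |v.1| ≤ 2 * l) (h2 : |v.2| ≤ 3 * l) :
    (v.2 = 0 ∧ |v.1| = 2 * l) ∨ (|v.2| = 3 * l ∧ |v.1| = l) := by
  obtain ⟨⟨k, hk, hk0⟩, s, hs⟩ := dvd_of_tripletFactor_eq_zero hl h
  have hlz : (0 : ℤ) < l := by exact_mod_cast hl
  have hs1 : |s| ≤ 1 := by
    rw [hs, abs_mul, abs_of_pos (by positivity : (0 : ℤ) < 3 * l)] at h2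
    by_contra hc
    nlinarith
  have hp : v.1 = l * (2 * k - 3 * s) := by linarith
  have hk2 : |2 * k - 3 * s| ≤ 2 := by
    rw [hp, abs_mul, abs_of_pos hlz] at h1
    by_contra hc
    nlinarith
  rw [hs, hp, abs_mul, abs_mul, abs_of_pos hlz, abs_of_pos (by positivity : (0 : ℤ) < 3 * l)]
  rw [abs_le] at hs1 hk2
  obtain rfl | rfl | rfl : s = 0 ∨ s = 1 ∨ s = -1 := by omega
  · left
    obtain rfl | rfl : k = 1 ∨ k = -1 := by omega
    · norm_num; ring
    · norm_num; ring
  · right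
    obtain rfl | rfl : k = 1 ∨ k = 2 := by omega
    · norm_num
    · norm_num
  · right
    obtain rfl | rfl : k = -1 ∨ k = -2 := by omega
    · norm_num
    · norm_num

end TripletFactor

/-! ### The visible box and the rigidity it enforces -/

/-- The nonzero frequencies `|p| ≤ 2l`, `|q| ≤ 3l` that are visible to triplets. -/
noncomputable def visibleBox (l : ℕ) : Finset (ℤ × ℤ) := by
  classical
  exact (Finset.Icc (-(2 * l : ℤ)) (2 * l) ×ˢ Finset.Icc (-(3 * l : ℤ)) (3 * l)).filter
    fun v => v ≠ 0 ∧ tripletFactor l v ≠ 0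

/-- The frequencies `0 ≤ p < 2l`, `0 ≤ q < 3l`. -/
noncomputable def frequencyCell (l : ℕ) : Finset (ℤ × ℤ) :=
  Finset.Ico (0 : ℤ) (2 * l) ×ˢ Finset.Ico (0 : ℤ) (3 * l)

lemma mem_visibleBox {l : ℕ} {v : ℤ × ℤ} :
    v ∈ visibleBox l ↔ (|v.1| ≤ 2 * l ∧ |v.2| ≤ 3 * l) ∧ v ≠ 0 ∧ tripletFactor l v ≠ 0 := by
  simp [visibleBox, abs_le]

lemma mem_frequencyCell {l : ℕ} {v : ℤ × ℤ} :
    v ∈ frequencyCell l ↔ (0 ≤ v.1 ∧ v.1 < 2 * l) ∧ 0 ≤ v.2 ∧ v.2 < 3 * l := by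
  simp [frequencyCell]

lemma card_frequencyCell (l : ℕ) : (frequencyCell l).card = 6 * l ^ 2 := by
  simp [frequencyCell, Finset.card_product]
  have h2 : ((2 * l : ℤ)).toNat = 2 * l := by omega
  have h3 : ((3 * l : ℤ)).toNat = 3 * l := by omega
  rw [h2, h3]
  ring

section VisibleBox

variable {l : ℕ}

lemma mem_visibleBox_of_not_hexagon (hl : 0 < l) {v : ℤ × ℤ} (h1 : |v.1| ≤ 2 * l)
    (h2 : |v.2| ≤ 3 * l) (h0 : v.1 = 0 → v.2 ≠ 0) (h3 : v.2 = 0 → |v.1| ≠ 2 * l)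
    (h4 : |v.2| = 3 * l → |v.1| ≠ l) : v ∈ visibleBox l := by
  rw [mem_visibleBox]
  refine ⟨⟨h1, h2⟩, fun h => h0 (by simp [h]) (by simp [h]), fun h => ?_⟩
  rcases tripletFactor_eq_zero_of_mem_box hl h h1 h2 with ⟨a, b⟩ | ⟨a, b⟩
  · exact h3 a b
  · exact h4 a b

/-- Differences within the half-open cell stay strictly inside the box, while the zeros of the
triplet factor lie on its boundary. -/
lemma sub_mem_visibleBox (hl : 0 < l) {u v : ℤ × ℤ} (hu : u ∈ frequencyCell l)
    (hv : v ∈ frequencyCell l) (huv : u ≠ v) : u - v ∈ visibleBox l := by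
  rw [mem_frequencyCell] at hu hv
  have : ¬ (u.1 = v.1 ∧ u.2 = v.2) := fun h => huv (Prod.ext h.1 h.2)
  apply mem_visibleBox_of_not_hexagon hl <;> simp only [Prod.fst_sub, Prod.snd_sub] <;> grind

/-- The generator itself is a hexagon vertex, hence invisible, but the difference reaches a vertex
only for `v = 0`. This is why the generator must replace `0` in the cell; the diagonal generator
behaves alike. -/
lemma horizontal_sub_mem_visibleBox (hl : 0 < l) {v : ℤ × ℤ} (hv : v ∈ frequencyCell l)
    (h0 : v ≠ 0) : ((2 * l : ℤ), (0 : ℤ)) - v ∈ visibleBox l := by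
  rw [mem_frequencyCell] at hv
  have : ¬ (v.1 = 0 ∧ v.2 = 0) := fun h => h0 (Prod.ext h.1 h.2)
  apply mem_visibleBox_of_not_hexagon hl <;> simp only [Prod.fst_sub, Prod.snd_sub] <;> grind

lemma diagonal_sub_mem_visibleBox (hl : 0 < l) {v : ℤ × ℤ} (hv : v ∈ frequencyCell l)
    (h0 : v ≠ 0) : ((l : ℤ), (3 * l : ℤ)) - v ∈ visibleBox l := by
  rw [mem_frequencyCell] at hv
  have : ¬ (v.1 = 0 ∧ v.2 = 0) := fun h => h0 (Prod.ext h.1 h.2)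
  apply mem_visibleBox_of_not_hexagon hl <;> simp only [Prod.fst_sub, Prod.snd_sub] <;> grind

/-- Separates gain from loss: no frequency at which the lattice carries energy is counted in the
visible intensity. -/
lemma visibleBox_ne_mul (hl : 0 < l) {p q : ℤ} (h : Even (p + q)) :
    ((p * (3 * l : ℕ), q * (3 * l : ℕ)) : ℤ × ℤ) ∉ visibleBox l := by
  intro hv
  obtain ⟨⟨h1, h2⟩, h0, -⟩ := mem_visibleBox.1 hv
  have hlz : (0 : ℤ) < l := by exact_mod_cast hl
  have hl3 : ((3 * l : ℕ) : ℤ) = 3 * l := by push_cast; rfl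
  simp only [hl3, abs_mul, abs_of_pos hlz, Nat.abs_ofNat] at h1 h2
  have hp : |p| < 1 := by
    by_contra hc
    nlinarith
  have hq : |q| < 2 := by
    by_contra hc
    nlinarith
  obtain rfl : p = 0 := Int.abs_lt_one_iff.1 hp
  rw [abs_lt] at hq
  obtain ⟨k, hk⟩ := h
  obtain rfl : q = 0 := by omega
  exact h0 (by simp)

variable {ι : Type*} [Fintype ι]

/-- The total intensity of a configuration in `visibleBox l`. -/
noncomputable def visibleIntensity (l : ℕ) (X : ι → ℝ × ℝ) : ℝ :=
  ∑ v ∈ visibleBox l, ‖expSum X v‖ ^ 2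

lemma visibleIntensity_nonneg (X : ι → ℝ × ℝ) : 0 ≤ visibleIntensity l X :=
  Finset.sum_nonneg fun _ _ => sq_nonneg _

lemma norm_expSum_sq_le_visibleIntensity (X : ι → ℝ × ℝ) {v : ℤ × ℤ} (hv : v ∈ visibleBox l) :
    ‖expSum X v‖ ^ 2 ≤ visibleIntensity l X :=
  Finset.single_le_sum (f := fun v => ‖expSum X v‖ ^ 2) (fun _ _ => sq_nonneg _) hv

lemma sum_sum_horizontal_le (hl : 0 < l) (hcard : Fintype.card ι = 6 * l ^ 2) (X : ι → ℝ × ℝ) :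
    ∑ m, ∑ k, ‖planeWave ((2 * l : ℤ), (0 : ℤ)) (X m - X k) - 1‖ ^ 2
      ≤ 4 * (Fintype.card ι : ℝ) ^ 2 * visibleIntensity l X := by
  classical
  refine sum_sum_norm_planeWave_sub_one_le X (A := frequencyCell l) ?_ ?_ ?_
    (visibleIntensity_nonneg X) ?_ ?_
  · simp [mem_frequencyCell, hl]
  · simp [mem_frequencyCell]
  · rw [card_frequencyCell, hcard]
  · exact fun u hu v hv h => norm_expSum_sq_le_visibleIntensity X (sub_mem_visibleBox hl hu hv h)
  · exact fun u hu h =>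
      norm_expSum_sq_le_visibleIntensity X (horizontal_sub_mem_visibleBox hl hu h)

lemma sum_sum_diagonal_le (hl : 0 < l) (hcard : Fintype.card ι = 6 * l ^ 2) (X : ι → ℝ × ℝ) :
    ∑ m, ∑ k, ‖planeWave ((l : ℤ), (3 * l : ℤ)) (X m - X k) - 1‖ ^ 2
      ≤ 4 * (Fintype.card ι : ℝ) ^ 2 * visibleIntensity l X := by
  classical
  refine sum_sum_norm_planeWave_sub_one_le X (A := frequencyCell l) ?_ ?_ ?_
    (visibleIntensity_nonneg X) ?_ ?_
  · simp [mem_frequencyCell, hl]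
  · simp [mem_frequencyCell]
  · rw [card_frequencyCell, hcard]
  · exact fun u hu v hv h => norm_expSum_sq_le_visibleIntensity X (sub_mem_visibleBox hl hu hv h)
  · exact fun u hu h =>
      norm_expSum_sq_le_visibleIntensity X (diagonal_sub_mem_visibleBox hl hu h)

/-- With `p + q = 2k`, the frequency `(pL, qL)` has coordinates `p + k - q` and `q` in the basis
`(2l, 0)`, `(l, 3l)`. Their squares sum to at most `5 (p² + q²)`, and `20 = 5 · 4`. -/
lemma card_sq_sub_norm_expSum_mul_sq_le (hl : 0 < l) (hcard : Fintype.card ι = 6 * l ^ 2)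
    (X : ι → ℝ × ℝ) {p q : ℤ} (h : Even (p + q)) :
    (Fintype.card ι : ℝ) ^ 2 - ‖expSum X (p * (3 * l : ℕ), q * (3 * l : ℕ))‖ ^ 2
      ≤ 20 * ((p : ℝ) ^ 2 + (q : ℝ) ^ 2) * (Fintype.card ι : ℝ) ^ 2 * visibleIntensity l X := by
  obtain ⟨k, hk⟩ := h
  have key := card_sq_sub_norm_expSum_sq_le X (sum_sum_horizontal_le hl hcard X)
    (sum_sum_diagonal_le hl hcard X) (p + k - q) q
  have e : (p + k - q) • ((2 * l : ℤ), (0 : ℤ)) + q • ((l : ℤ), (3 * l : ℤ))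
      = (p * (3 * l : ℕ), q * (3 * l : ℕ)) := by
    ext
    · simp
      linear_combination (-l : ℤ) * hk
    · simp
  rw [e] at key
  refine key.trans ?_
  have hkr : (p + q : ℝ) = k + k := by exact_mod_cast hk
  have h5 : ((p + k - q : ℤ) : ℝ) ^ 2 + (q : ℝ) ^ 2 ≤ 5 * ((p : ℝ) ^ 2 + (q : ℝ) ^ 2) := by
    have : (k : ℝ) = (p + q) / 2 := by linarith
    push_cast
    rw [this]
    nlinarith [sq_nonneg (3 * (p : ℝ) + q)]
  have h0 : 0 ≤ 4 * (Fintype.card ι : ℝ) ^ 2 * visibleIntensity l X := by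
    have := visibleIntensity_nonneg (l := l) X
    positivity
  nlinarith [mul_le_mul_of_nonneg_right h5 h0]

lemma planeWave_eq_one_of_sum_le_zero {X : ι → ℝ × ℝ} {w : ℤ × ℤ}
    (h : ∑ m, ∑ k, ‖planeWave w (X m - X k) - 1‖ ^ 2 ≤ 0) (m k : ι) :
    planeWave w (X m - X k) = 1 := by
  have h0 : ∀ m k : ι, 0 ≤ ‖planeWave w (X m - X k) - 1‖ ^ 2 := fun _ _ => sq_nonneg _
  have h1 := (Finset.sum_eq_zero_iff_of_nonneg fun m _ => Finset.sum_nonneg fun k _ => h0 m k).1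
    (h.antisymm (Finset.sum_nonneg fun m _ => Finset.sum_nonneg fun k _ => h0 m k)) m
      (Finset.mem_univ _)
  have h2 := (Finset.sum_eq_zero_iff_of_nonneg fun k _ => h0 m k).1 h1 k (Finset.mem_univ _)
  simpa [sub_eq_zero] using h2

lemma planeWave_eq_one_of_visibleIntensity_eq_zero (hl : 0 < l)
    (hcard : Fintype.card ι = 6 * l ^ 2) {X : ι → ℝ × ℝ} (h : visibleIntensity l X = 0) (m k : ι) :
    planeWave ((2 * l : ℤ), (0 : ℤ)) (X m - X k) = 1 ∧
      planeWave ((l : ℤ), (3 * l : ℤ)) (X m - X k) = 1 := by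
  have h1 := sum_sum_horizontal_le hl hcard X
  have h2 := sum_sum_diagonal_le hl hcard X
  rw [h, mul_zero] at h1 h2
  exact ⟨planeWave_eq_one_of_sum_le_zero h1 m k, planeWave_eq_one_of_sum_le_zero h2 m k⟩

/-- With zero intensity the cell polynomial vanishes at every difference of distinct points, whereas
at a period it equals the number of its terms. -/
lemma not_periodEq_of_visibleIntensity_eq_zero (hl : 0 < l) (hcard : Fintype.card ι = 6 * l ^ 2)
    {X : ι → ℝ × ℝ} (h : visibleIntensity l X = 0) {m k : ι} (hmk : m ≠ k) :
    ¬ PeriodEq (X m) (X k) := by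
  classical
  intro hp
  have h1 := sum_sum_norm_sum_planeWave_le X (A := frequencyCell l)
    (by rw [card_frequencyCell, hcard]) (visibleIntensity_nonneg X)
    (fun u hu v hv h => norm_expSum_sq_le_visibleIntensity X (sub_mem_visibleBox hl hu hv h))
  rw [h, mul_zero] at h1
  have h0 (m k : ι) :
      0 ≤ (if m = k then 0 else ‖∑ v ∈ frequencyCell l, planeWave v (X m - X k)‖ ^ 2) := by
    split_ifs <;> positivity
  have h2 := (Finset.single_le_sum (f := fun k => if m = k then 0 else
    ‖∑ v ∈ frequencyCell l, planeWave v (X m - X k)‖ ^ 2) (fun k _ => h0 m k)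
    (Finset.mem_univ k)).trans ((Finset.single_le_sum (f := fun m => ∑ k, if m = k then 0 else
    ‖∑ v ∈ frequencyCell l, planeWave v (X m - X k)‖ ^ 2)
    (fun m _ => Finset.sum_nonneg fun k _ => h0 m k) (Finset.mem_univ m)).trans h1)
  have h3 (v : ℤ × ℤ) : planeWave v (X m - X k) = 1 := by
    rw [planeWave_sub, planeWave_congr hp, Complex.mul_conj', norm_planeWave]
    simp
  simp only [if_neg hmk, h3, Finset.sum_const, card_frequencyCell, nsmul_eq_mul, mul_one,
    Complex.norm_natCast] at h2
  have : (0 : ℝ) < ((6 * l ^ 2 : ℕ) : ℝ) ^ 2 := by positivity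
  linarith

end VisibleBox

/-! ### The energy gap -/

section EnergyGap

variable {l : ℕ} {ι : Type*} [Fintype ι]

lemma norm_tripletFactor_le (v : ℤ × ℤ) : ‖tripletFactor l v‖ ≤ 3 := by
  refine (norm_add_le _ _).trans ?_
  rw [norm_planeWave]
  refine (add_le_add_left (norm_add_le _ _) 1).trans ?_
  rw [norm_planeWave, norm_one]
  norm_num

lemma epsTildeTerm_nonneg {a : ℤ × ℤ → ℝ} (ha : ∀ v, 0 < a v) (L : ℕ) (v : ℤ × ℤ) :
    0 ≤ epsTildeTerm a L v := by
  have h1 : 0 ≤ 1 + (-1 : ℝ) ^ (v.1 + v.2) := by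
    rcases Int.even_or_odd (v.1 + v.2) with h | h
    · rw [h.neg_one_zpow]; norm_num
    · rw [h.neg_one_zpow]; norm_num
  have := (ha (v.1 * L, v.2 * L)).le
  rw [epsTildeTerm]
  positivity

lemma epsTilde_nonneg {a : ℤ × ℤ → ℝ} (ha : ∀ v, 0 < a v) (L : ℕ) : 0 ≤ epsTilde a L := by
  have : 0 ≤ ∑' v, epsTildeTerm a L v := tsum_nonneg (epsTildeTerm_nonneg ha L)
  rw [epsTilde]
  positivity

/-- The energy of any triplet configuration exceeds that of one with only reciprocal lattice
frequencies by a multiple of its visible intensity. -/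
lemma energy_sub_ge (hl : 0 < l) (hcard : Fintype.card ι = 6 * l ^ 2) {a : ℤ × ℤ → ℝ}
    (ha : ∀ v, 0 < a v) {X Y : ι → ℝ × ℝ} {GX GY : ℝ}
    (hX : HasSum (fun v => a v * (‖tripletFactor l v‖ ^ 2 * ‖expSum X v‖ ^ 2)) GX)
    (hY : HasSum (fun v => a v * (‖tripletFactor l v‖ ^ 2 * ‖expSum Y v‖ ^ 2)) GY)
    (hY' : ∀ v, tripletFactor l v ≠ 0 → expSum Y v ≠ 0 →
      ∃ p q : ℤ, v = (p * (3 * l : ℕ), q * (3 * l : ℕ)) ∧ Even (p + q))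
    (hs : Summable (epsTildeTerm a (3 * l))) {c : ℝ}
    (hlow : ∀ m n : ℤ, |m| ≤ 2 * l → |n| ≤ 3 * l → c ≤ a (m, n)) :
    visibleIntensity l X * (c * (1 / (252 * (l : ℝ) ^ 2)) ^ 2 - 720 * l ^ 2 * epsTilde a (3 * l))
      ≤ GX - GY := by
  classical
  set M : ℝ := (Fintype.card ι : ℝ) with hM
  set D := visibleIntensity l X with hD
  have hD0 : 0 ≤ D := visibleIntensity_nonneg X
  set φ : ℤ × ℤ → ℤ × ℤ := fun v => (v.1 * (3 * l : ℕ), v.2 * (3 * l : ℕ)) with hφ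
  have hinj : Function.Injective φ := by
    have hl3 : ((3 * l : ℕ) : ℤ) ≠ 0 := by positivity
    intro u v huv
    simp only [hφ, Prod.mk.injEq] at huv
    exact Prod.ext (mul_right_cancel₀ hl3 huv.1) (mul_right_cancel₀ hl3 huv.2)
  -- The `ε̃` series is carried to the frequencies `(pL, qL)` and set to zero elsewhere. Here `90 =
  -- 9 · 20 / 2`: `|T|² ≤ 9`, the deficit constant, and the bracket `1 + (-1)^(p+q) = 2` inside
  -- `epsTildeTerm`.
  set loss : ℤ × ℤ → ℝ :=
    Function.extend φ (fun v => 90 * M ^ 2 * D * epsTildeTerm a (3 * l) v) 0 with hloss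
  have hloss_sum : HasSum loss (90 * M ^ 2 * D * ∑' v, epsTildeTerm a (3 * l) v) :=
    (hasSum_extend_zero hinj).2 (hs.hasSum.mul_left _)
  have hloss_nonneg (v : ℤ × ℤ) : 0 ≤ loss v := by
    by_cases hv : ∃ u, φ u = v
    · obtain ⟨u, rfl⟩ := hv
      rw [hloss, hinj.extend_apply]
      have := epsTildeTerm_nonneg ha (3 * l) u
      positivity
    · rw [hloss, Function.extend_apply' _ _ _ hv]
      rfl
  set gain : ℤ × ℤ → ℝ := fun v =>
    if v ∈ visibleBox l then c * (1 / (252 * (l : ℝ) ^ 2)) ^ 2 * ‖expSum X v‖ ^ 2 else 0 with hgain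
  have hgain_sum : HasSum gain (c * (1 / (252 * (l : ℝ) ^ 2)) ^ 2 * D) := by
    have := hasSum_sum_of_ne_finset_zero (f := gain) (s := visibleBox l)
      (L := SummationFilter.unconditional _) (fun v hv => if_neg hv)
    convert this using 1
    rw [hD, visibleIntensity, Finset.mul_sum]
    exact Finset.sum_congr rfl fun v hv => (if_pos hv).symm
  -- Mode by mode: where the lattice carries energy, the deficit estimate applies; elsewhere its
  -- term is zero and only the visible part of the competitor's energy is kept.
  have key (v : ℤ × ℤ) : gain v - loss v ≤ a v * (‖tripletFactor l v‖ ^ 2 * ‖expSum X v‖ ^ 2)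
      - a v * (‖tripletFactor l v‖ ^ 2 * ‖expSum Y v‖ ^ 2) := by
    by_cases hv : tripletFactor l v ≠ 0 ∧ expSum Y v ≠ 0
    · obtain ⟨p, q, rfl, hpq⟩ := hY' v hv.1 hv.2
      have hg : gain (p * (3 * l : ℕ), q * (3 * l : ℕ)) = 0 := if_neg (visibleBox_ne_mul hl hpq)
      have hlo : loss (p * (3 * l : ℕ), q * (3 * l : ℕ))
          = 180 * M ^ 2 * D * ((p : ℝ) ^ 2 + (q : ℝ) ^ 2) *
            a (p * (3 * l : ℕ), q * (3 * l : ℕ)) := by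
        have : loss (φ (p, q)) = 90 * M ^ 2 * D * epsTildeTerm a (3 * l) (p, q) :=
          hinj.extend_apply _ _ _
        rw [show ((p * (3 * l : ℕ), q * (3 * l : ℕ)) : ℤ × ℤ) = φ (p, q) from rfl, this,
          epsTildeTerm, hpq.neg_one_zpow]
        ring
      rw [hg, hlo, ← mul_sub, ← mul_sub]
      have h1 := card_sq_sub_norm_expSum_mul_sq_le hl hcard X hpq
      rw [← hM, ← hD] at h1
      set w : ℤ × ℤ := (p * (3 * l : ℕ), q * (3 * l : ℕ))
      have hYM : ‖expSum Y w‖ ^ 2 ≤ M ^ 2 :=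
        pow_le_pow_left₀ (norm_nonneg _) (norm_expSum_le Y w) 2
      have hXM : ‖expSum X w‖ ^ 2 ≤ M ^ 2 :=
        pow_le_pow_left₀ (norm_nonneg _) (norm_expSum_le X w) 2
      have hT : ‖tripletFactor l w‖ ^ 2 ≤ 9 := by
        have := pow_le_pow_left₀ (norm_nonneg _) (norm_tripletFactor_le (l := l) w) 2
        norm_num at this
        exact this
      have h2 : ‖tripletFactor l w‖ ^ 2 * (M ^ 2 - ‖expSum X w‖ ^ 2)
          ≤ 9 * (20 * ((p : ℝ) ^ 2 + (q : ℝ) ^ 2) * M ^ 2 * D) :=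
        mul_le_mul hT h1 (by linarith) (by norm_num)
      have h3 : ‖tripletFactor l w‖ ^ 2 * (‖expSum Y w‖ ^ 2 - ‖expSum X w‖ ^ 2)
          ≤ ‖tripletFactor l w‖ ^ 2 * (M ^ 2 - ‖expSum X w‖ ^ 2) :=
        mul_le_mul_of_nonneg_left (by linarith) (sq_nonneg _)
      have := mul_le_mul_of_nonneg_left (h3.trans h2) (ha w).le
      linarith
    · have h0 : ‖tripletFactor l v‖ ^ 2 * ‖expSum Y v‖ ^ 2 = 0 := by
        rw [not_and_or, not_not, not_not] at hv
        rcases hv with h | h <;> simp [h]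
      rw [h0, mul_zero, sub_zero]
      refine (sub_le_self _ (hloss_nonneg v)).trans ?_
      simp only [hgain]
      split_ifs with hvb
      · obtain ⟨⟨h1, h2⟩, -, hT⟩ := mem_visibleBox.1 hvb
        rw [mul_assoc]
        refine mul_le_mul (hlow v.1 v.2 h1 h2) ?_ (by positivity) (ha v).le
        gcongr
        exact norm_tripletFactor_ge hl hT
      · have := (ha v).le
        positivity
  have hfin := hasSum_le key (hgain_sum.sub hloss_sum) (hX.sub hY)
  refine le_trans (le_of_eq ?_) hfin
  rw [epsTilde, hM, hcard]
  push_cast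
  ring

/-- Exponential smallness makes the coefficient in `energy_sub_ge` positive. -/
lemma eventually_coefficient_pos {a : ℤ × ℤ → ℝ} (ha : ∀ v, 0 < a v) {lam : ℝ} (hlam : 0 < lam)
    (hsmall : ExpSmall a lam) {C : ℝ} (hC : 0 < C) :
    ∀ᶠ l : ℕ in atTop, 720 * (l : ℝ) ^ 2 * epsTilde a (3 * l)
      < C * a (2 * l, 3 * l) * (1 / (252 * (l : ℝ) ^ 2)) ^ 2 := by
  -- The power 6 collects the `l²` in front of `ε̃` and the `l⁴` from the squared lower bound on the
  -- triplet factor.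
  have hexp : ∀ᶠ l : ℕ in atTop, (l : ℝ) ^ 6 ≤ Real.exp (lam * ((3 * l : ℕ) : ℝ)) := by
    have h1 : Tendsto (fun t : ℝ => t ^ 6 / Real.exp (3 * lam * t)) atTop (𝓝 0) := by
      have := (isLittleO_pow_exp_pos_mul_atTop 6 (b := 3 * lam) (by positivity))
      exact this.tendsto_div_nhds_zero
    have h2 := (h1.comp tendsto_natCast_atTop_atTop).eventually_lt_const one_pos
    filter_upwards [h2] with l h
    simp only [Function.comp_apply] at h
    rw [div_lt_one (Real.exp_pos _)] at h
    refine h.le.trans (le_of_eq ?_)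
    push_cast
    ring_nf
  have hlt := hsmall.2.eventually_lt_const (show 0 < C / (720 * 252 ^ 2) by positivity)
  filter_upwards [hexp, hlt, eventually_gt_atTop 0] with l h1 h2 hl
  have hl' : (0 : ℝ) < l := by exact_mod_cast hl
  have ha' := ha (2 * l, 3 * l)
  have he := epsTilde_nonneg ha (3 * l)
  have h3 : (l : ℝ) ^ 6 * epsTilde a (3 * l) < C / (720 * 252 ^ 2) * a (2 * l, 3 * l) := by
    rw [mul_div_assoc', div_lt_iff₀ ha'] at h2
    exact (mul_le_mul_of_nonneg_right h1 he).trans_lt h2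
  rw [div_pow, one_pow, mul_one_div, lt_div_iff₀ (by positivity)]
  calc _ = 720 * 252 ^ 2 * ((l : ℝ) ^ 6 * epsTilde a (3 * l)) := by ring
    _ < 720 * 252 ^ 2 * (C / (720 * 252 ^ 2) * a (2 * l, 3 * l)) := by gcongr
    _ = _ := by ring

end EnergyGap

/-! ### Congruence modulo the periods and the base lattice -/

lemma PeriodEq.refl (u : ℝ × ℝ) : PeriodEq u u := ⟨0, 0, by simp⟩

lemma PeriodEq.symm {u v : ℝ × ℝ} (h : PeriodEq u v) : PeriodEq v u := by
  obtain ⟨i, j, rfl⟩ := h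
  exact ⟨-i, -j, by ext <;> simp⟩

lemma PeriodEq.trans {u v w : ℝ × ℝ} (h : PeriodEq u v) (h' : PeriodEq v w) : PeriodEq u w := by
  obtain ⟨i, j, rfl⟩ := h
  obtain ⟨i', j', rfl⟩ := h'
  exact ⟨i' + i, j' + j, by ext <;> simp <;> ring⟩

lemma PeriodEq.add_left {u v : ℝ × ℝ} (h : PeriodEq u v) (t : ℝ × ℝ) :
    PeriodEq (t + u) (t + v) := by
  obtain ⟨i, j, rfl⟩ := h
  exact ⟨i, j, by rw [add_assoc]⟩

lemma PeriodEq.add_right {u v : ℝ × ℝ} (h : PeriodEq u v) (t : ℝ × ℝ) :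
    PeriodEq (u + t) (v + t) := by
  simpa only [add_comm _ t] using h.add_left t

lemma PeriodEq.of_add_left {t u v : ℝ × ℝ} (h : PeriodEq (t + u) (t + v)) : PeriodEq u v := by
  simpa using h.add_left (-t)

/-- The points of the base lattice of the triplets in terms of a lattice basis. -/
noncomputable def baseLatticePoint (l : ℕ) (a b : ℤ) : ℝ × ℝ :=
  (Real.sqrt 3 * (2 * a - 1) / (4 * l), (2 * b - a + 1) / (6 * l))

section BaseLattice

variable {l : ℕ}

/-- The period `(√3, 0)` is `2l` steps in the first basis direction and `l` in the second, whence
the shear `l * i`; the period `(0, 1)` is `3l` steps in the second. -/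
lemma periodEq_baseLatticePoint_iff (hl : 0 < l) {a b a' b' : ℤ} :
    PeriodEq (baseLatticePoint l a b) (baseLatticePoint l a' b') ↔
      ∃ i j : ℤ, a = a' + 2 * l * i ∧ b = b' + l * i + 3 * l * j := by
  have hl' : (l : ℝ) ≠ 0 := by exact_mod_cast hl.ne'
  have hs : Real.sqrt 3 ≠ 0 := by positivity
  simp only [PeriodEq, baseLatticePoint, Prod.mk_add_mk, Prod.mk.injEq]
  refine exists_congr fun i => exists_congr fun j => ?_
  have e1 : Real.sqrt 3 * (2 * a - 1) / (4 * l) = Real.sqrt 3 * (2 * a' - 1) / (4 * l)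
      + Real.sqrt 3 * i ↔ a = a' + 2 * l * i := by
    rw [← @Int.cast_inj ℝ]
    push_cast
    field_simp
    constructor <;> intro h <;> linarith
  have e2 : (2 * b - a + 1 : ℝ) / (6 * l) = (2 * b' - a' + 1) / (6 * l) + j ↔
      2 * b - a = 2 * b' - a' + 6 * l * j := by
    rw [← @Int.cast_inj ℝ]
    push_cast
    field_simp
    constructor <;> intro h <;> linarith
  rw [e1, e2]
  constructor <;> rintro ⟨h1, h2⟩ <;> refine ⟨h1, ?_⟩ <;> linarith

lemma latticeBase_eq (hl : 0 < l) :
    latticeBase (3 * l) = {u | ∃ a b : ℤ, u = baseLatticePoint l a b} := by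
  have hl' : (l : ℝ) ≠ 0 := by exact_mod_cast hl.ne'
  have hlz : (0 : ℤ) < l := by exact_mod_cast hl
  -- The zigzag of the rows in `k` is absorbed into the lattice coordinate `b = j + ⌊k/2⌋`.
  have hpt (k j : ℕ) : ((3 * Real.sqrt 3 * (2 * (k : ℝ) - 1) / (4 * ((3 * l : ℕ) : ℝ)),
      (4 * (j : ℝ) + (1 + (-1 : ℝ) ^ k)) / (4 * ((3 * l : ℕ) : ℝ))) : ℝ × ℝ)
      = baseLatticePoint l k (j + (k / 2 : ℕ)) := by
    rcases Nat.even_or_odd' k with ⟨c, rfl | rfl⟩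
    · have : 2 * c / 2 = c := by omega
      rw [baseLatticePoint, this, (even_two_mul c).neg_one_pow]
      ext
      · push_cast; field_simp
      · push_cast; field_simp; ring
    · have : (2 * c + 1) / 2 = c := by omega
      rw [baseLatticePoint, this, (odd_two_mul_add_one c).neg_one_pow]
      ext
      · push_cast; field_simp
      · push_cast; field_simp; ring
  ext u
  constructor
  · rintro ⟨w, ⟨k, j, -, -, rfl⟩, i, j', rfl⟩
    rw [hpt]
    refine ⟨k + 2 * l * i, j + (k / 2 : ℕ) + l * i + 3 * l * j', ?_⟩
    ext <;> simp only [baseLatticePoint, Prod.fst_add, Prod.snd_add] <;> push_cast <;>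
      field_simp <;> ring
  · rintro ⟨a, b, rfl⟩
    set k : ℕ := ((a - 1) % (2 * l) + 1).toNat with hk
    set i := (a - 1) / (2 * l)
    have h1 := Int.emod_add_mul_ediv (a - 1) (2 * l)
    have h2 := Int.emod_nonneg (a - 1) (show (2 * l : ℤ) ≠ 0 by positivity)
    have h3 := Int.emod_lt_of_pos (a - 1) (show (0 : ℤ) < 2 * l by positivity)
    set r := b - l * i - (k / 2 : ℕ) - 1 with hr
    set j : ℕ := (r % (3 * l) + 1).toNat with hj
    have h4 := Int.emod_add_mul_ediv r (3 * l)
    have h5 := Int.emod_nonneg r (show (3 * l : ℤ) ≠ 0 by positivity)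
    have h6 := Int.emod_lt_of_pos r (show (0 : ℤ) < 3 * l by positivity)
    have hkz : (k : ℤ) = (a - 1) % (2 * l) + 1 := Int.toNat_of_nonneg (by linarith)
    have hjz : (j : ℤ) = r % (3 * l) + 1 := Int.toNat_of_nonneg (by linarith)
    refine ⟨_, ⟨k, j, ⟨?_, ?_⟩, ⟨?_, ?_⟩, rfl⟩, ?_⟩
    · omega
    · rw [show 2 * (3 * l) / 3 = 2 * l by omega]
      omega
    · omega
    · omega
    · rw [hpt, periodEq_baseLatticePoint_iff hl]
      exact ⟨i, r / (3 * l), by linarith, by linarith⟩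

lemma exists_fin_periodEq (hl : 0 < l) (a b : ℤ) : ∃ c : Fin (2 * l) × Fin (3 * l),
    PeriodEq (baseLatticePoint l a b) (baseLatticePoint l (c.1 : ℕ) (c.2 : ℕ)) := by
  have hlz : (0 : ℤ) < l := by exact_mod_cast hl
  have h1 := Int.emod_add_mul_ediv a (2 * l)
  have h2 := Int.emod_nonneg a (show (2 * l : ℤ) ≠ 0 by positivity)
  have h3 := Int.emod_lt_of_pos a (show (0 : ℤ) < 2 * l by positivity)
  set r := b - l * (a / (2 * l)) with hr
  have h4 := Int.emod_add_mul_ediv r (3 * l)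
  have h5 := Int.emod_nonneg r (show (3 * l : ℤ) ≠ 0 by positivity)
  have h6 := Int.emod_lt_of_pos r (show (0 : ℤ) < 3 * l by positivity)
  refine ⟨(⟨(a % (2 * l)).toNat, by omega⟩, ⟨(r % (3 * l)).toNat, by omega⟩), ?_⟩
  rw [periodEq_baseLatticePoint_iff hl]
  refine ⟨a / (2 * l), r / (3 * l), ?_, ?_⟩
  · simp only [Int.toNat_of_nonneg h2]
    linarith
  · simp only [Int.toNat_of_nonneg h5]
    linarith

lemma fin_eq_of_periodEq (hl : 0 < l) {c d : Fin (2 * l) × Fin (3 * l)}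
    (h : PeriodEq (baseLatticePoint l (c.1 : ℕ) (c.2 : ℕ))
      (baseLatticePoint l (d.1 : ℕ) (d.2 : ℕ))) : c = d := by
  obtain ⟨i, j, h1, h2⟩ := (periodEq_baseLatticePoint_iff hl).1 h
  have hlz : (0 : ℤ) < l := by exact_mod_cast hl
  have c1 := c.1.2
  have c2 := c.2.2
  have d1 := d.1.2
  have d2 := d.2.2
  have hi : |i| < 1 := by
    rw [abs_lt]
    constructor <;> by_contra hc <;> nlinarith
  obtain rfl := Int.abs_lt_one_iff.1 hi
  have hj : |j| < 1 := by
    rw [abs_lt]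
    constructor <;> by_contra hc <;> nlinarith
  obtain rfl := Int.abs_lt_one_iff.1 hj
  exact Prod.ext (Fin.ext (by omega)) (Fin.ext (by omega))

variable {ι : Type*} [Fintype ι]

/-- The points `X n` are, modulo the periods, the points of the translate by `t` of the base
lattice, each taken once. -/
def IsBaseLattice (l : ℕ) (X : ι → ℝ × ℝ) (t : ℝ × ℝ) : Prop :=
  ∃ e : ι ≃ Fin (2 * l) × Fin (3 * l), ∀ n,
    PeriodEq (X n) (t + baseLatticePoint l ((e n).1 : ℕ) ((e n).2 : ℕ))

/-- Equality of sets already excludes repetitions, since the base lattice has exactly as many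
classes modulo the periods as there are indices. -/
lemma periodize_range_eq_iff (hl : 0 < l) (hcard : Fintype.card ι = 6 * l ^ 2) (X : ι → ℝ × ℝ)
    (t : ℝ × ℝ) :
    periodize (Set.range X) = translateSet t (latticeBase (3 * l)) ↔ IsBaseLattice l X t := by
  have hcard' : Fintype.card ι = Fintype.card (Fin (2 * l) × Fin (3 * l)) := by
    rw [hcard]
    simp
    ring
  rw [latticeBase_eq hl]
  constructor
  · intro h
    have hex (c : Fin (2 * l) × Fin (3 * l)) : ∃ n, PeriodEq (X n)
        (t + baseLatticePoint l (c.1 : ℕ) (c.2 : ℕ)) := by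
      have : t + baseLatticePoint l (c.1 : ℕ) (c.2 : ℕ) ∈ periodize (Set.range X) := by
        rw [h]
        exact ⟨_, ⟨_, _, rfl⟩, rfl⟩
      obtain ⟨_, ⟨n, rfl⟩, hn⟩ := this
      exact ⟨n, hn.symm⟩
    choose g hg using hex
    have hinj : Function.Injective g := by
      intro c d hcd
      have h1 := hg c
      rw [hcd] at h1
      exact fin_eq_of_periodEq hl (h1.symm.trans (hg d)).of_add_left
    have hbij := (Fintype.bijective_iff_injective_and_card g).2 ⟨hinj, hcard'.symm⟩
    refine ⟨(Equiv.ofBijective g hbij).symm, fun n => ?_⟩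
    have := hg ((Equiv.ofBijective g hbij).symm n)
    rwa [Equiv.ofBijective_apply_symm_apply g hbij n] at this
  · rintro ⟨e, he⟩
    ext u
    constructor
    · rintro ⟨_, ⟨n, rfl⟩, hn⟩
      have h1 : PeriodEq (u - t) (baseLatticePoint l ((e n).1 : ℕ) ((e n).2 : ℕ)) :=
        PeriodEq.of_add_left (t := t) (by simpa using hn.trans (he n))
      have h2 : u - t ∈ latticeBase (3 * l) := by
        obtain ⟨v, hv, hv'⟩ : baseLatticePoint l ((e n).1 : ℕ) ((e n).2 : ℕ)
            ∈ latticeBase (3 * l) := by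
          rw [latticeBase_eq hl]
          exact ⟨_, _, rfl⟩
        exact ⟨v, hv, h1.trans hv'⟩
      rw [latticeBase_eq hl] at h2
      exact ⟨u - t, h2, by simp⟩
    · rintro ⟨_, ⟨a, b, rfl⟩, rfl⟩
      obtain ⟨c, hc⟩ := exists_fin_periodEq hl a b
      refine ⟨X (e.symm c), ⟨_, rfl⟩, (hc.add_left t).trans ?_⟩
      have := he (e.symm c)
      rw [Equiv.apply_symm_apply] at this
      exact this.symm

lemma isBaseLattice_of_visibleIntensity_eq_zero (hl : 0 < l)
    (hcard : Fintype.card ι = 6 * l ^ 2) {X : ι → ℝ × ℝ} (h : visibleIntensity l X = 0) :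
    ∃ t, IsBaseLattice l X t := by
  have hl' : (l : ℝ) ≠ 0 := by exact_mod_cast hl.ne'
  have hs : Real.sqrt 3 ≠ 0 := by positivity
  have hcard' : Fintype.card ι = Fintype.card (Fin (2 * l) × Fin (3 * l)) := by
    rw [hcard]
    simp
    ring
  obtain ⟨n₀⟩ : Nonempty ι := by
    rw [← Fintype.card_pos_iff, hcard]
    positivity
  set t := X n₀ - baseLatticePoint l 0 0 with ht
  have hex (n : ι) : ∃ c : Fin (2 * l) × Fin (3 * l), PeriodEq (X n)
      (t + baseLatticePoint l (c.1 : ℕ) (c.2 : ℕ)) := by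
    obtain ⟨h1, h2⟩ := planeWave_eq_one_of_visibleIntensity_eq_zero hl hcard h n n₀
    rw [planeWave_eq_one_iff] at h1 h2
    obtain ⟨a, ha⟩ := h1
    obtain ⟨b, hb⟩ := h2
    obtain ⟨c, hc⟩ := exists_fin_periodEq hl a b
    refine ⟨c, ?_⟩
    -- The two frequencies are dual to the basis of the base lattice, so the integers `a` and `b`
    -- are the coordinates of `X n - X n₀`.
    have e : X n = t + baseLatticePoint l a b := by
      push_cast at ha hb
      rw [ht]
      ext
      · simp only [baseLatticePoint, Prod.fst_add, Prod.fst_sub] at ha hb ⊢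
        push_cast
        field_simp at ha ⊢
        linarith
      · simp only [baseLatticePoint, Prod.snd_add, Prod.snd_sub, Prod.fst_sub] at ha hb ⊢
        push_cast
        field_simp at ha hb ⊢
        have hmul : Real.sqrt 3 * (6 * l * ((X n).2 - (X n₀).2) - (2 * b - a)) = 0 := by
          linear_combination 2 * hb - ha
        have := (mul_eq_zero.1 hmul).resolve_left hs
        linarith
    rw [e]
    exact hc.add_left t
  choose g hg using hex
  have hinj : Function.Injective g := by
    intro m n hmn
    by_contra hne
    refine not_periodEq_of_visibleIntensity_eq_zero hl hcard h hne ?_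
    have h1 := hg m
    rw [hmn] at h1
    exact h1.trans (hg n).symm
  exact ⟨t, Equiv.ofBijective g ((Fintype.bijective_iff_injective_and_card g).2 ⟨hinj, hcard'⟩),
    hg⟩

/-- Off its reciprocal lattice the exponential sums of the base lattice vanish. -/
lemma IsBaseLattice.exists_of_expSum_ne_zero (hl : 0 < l) {X : ι → ℝ × ℝ} {t : ℝ × ℝ}
    (h : IsBaseLattice l X t) {v : ℤ × ℤ} (hv : expSum X v ≠ 0) :
    ∃ r s : ℤ, v = (l * (s + 2 * r), 3 * l * s) := by
  have hl' : (l : ℝ) ≠ 0 := by exact_mod_cast hl.ne'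
  have hs : Real.sqrt 3 ≠ 0 := by positivity
  obtain ⟨e, he⟩ := h
  set g₁ : ℝ × ℝ := (Real.sqrt 3 / (2 * l), -1 / (6 * l)) with hg₁
  set g₂ : ℝ × ℝ := (0, 1 / (3 * l)) with hg₂
  have hpow (n : ℕ) (g : ℝ × ℝ) : planeWave v ((n : ℝ) • g) = planeWave v g ^ n := by
    induction n with
    | zero => simp
    | succ n ih => rw [pow_succ, ← ih, ← planeWave_add]; congr 1; push_cast; module
  -- Over a full parallelogram of lattice points the sum is a product of two geometric sums.
  have hsum : expSum X v = planeWave v (t + baseLatticePoint l 0 0) *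
      ((∑ k ∈ Finset.range (2 * l), planeWave v g₁ ^ k) *
        ∑ j ∈ Finset.range (3 * l), planeWave v g₂ ^ j) := by
    rw [expSum, Finset.sum_range, Finset.sum_range, Finset.sum_mul_sum, Finset.mul_sum]
    rw [← e.symm.sum_comp, Fintype.sum_prod_type]
    refine Finset.sum_congr rfl fun k _ => ?_
    rw [Finset.mul_sum]
    refine Finset.sum_congr rfl fun j _ => ?_
    rw [planeWave_congr (he _), ← hpow, ← hpow, ← planeWave_add, ← planeWave_add]
    congr 1
    rw [add_assoc]
    congr 1
    ext
    · simp [baseLatticePoint, hg₁, hg₂]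
      field_simp
      ring
    · simp [baseLatticePoint, hg₁, hg₂]
      field_simp
      ring
  have hgeom {z : ℂ} {n : ℕ} (hz : z ^ n = 1) (h0 : ∑ k ∈ Finset.range n, z ^ k ≠ 0) : z = 1 := by
    have := mul_geom_sum z n
    rw [hz, sub_self, mul_eq_zero] at this
    exact sub_eq_zero.1 (this.resolve_right h0)
  rw [hsum] at hv
  have hv1 := left_ne_zero_of_mul (right_ne_zero_of_mul hv)
  have hv2 := right_ne_zero_of_mul (right_ne_zero_of_mul hv)
  have hb : planeWave v g₂ = 1 := by
    refine hgeom ?_ hv2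
    rw [← hpow, planeWave_eq_one_iff]
    refine ⟨v.2, ?_⟩
    simp [hg₂]
    field_simp
  obtain ⟨s, hs'⟩ := (planeWave_eq_one_iff _ _).1 hb
  have h2 : (v.2 : ℝ) = 3 * l * s := by
    simp only [hg₂, mul_zero, zero_div, zero_add] at hs'
    field_simp at hs'
    linarith
  -- The order matters: `2l` steps along `g₁` do not form a period, and their phase is integral only
  -- because `v.2` is already known to be a multiple of `3l`.
  have hα : planeWave v g₁ = 1 := by
    refine hgeom ?_ hv1
    rw [← hpow, planeWave_eq_one_iff]
    refine ⟨v.1 - l * s, ?_⟩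
    simp [hg₁, h2]
    field_simp
    ring
  obtain ⟨r, hr⟩ := (planeWave_eq_one_iff _ _).1 hα
  have h1 : (v.1 : ℝ) = l * (s + 2 * r) := by
    simp only [hg₁, h2] at hr
    field_simp at hr
    linarith
  exact ⟨r, s, Prod.ext (by exact_mod_cast h1) (by exact_mod_cast h2)⟩

/-- Here the middle wave has phase `(2s + r) / 3`, a nontrivial cube root of unity under `h`, and
the last wave is its square. -/
lemma tripletFactor_eq_zero (hl : 0 < l) {r s : ℤ} (h : ¬ (3 : ℤ) ∣ s + 2 * r) :
    tripletFactor l (l * (s + 2 * r), 3 * l * s) = 0 := by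
  have hl' : (l : ℝ) ≠ 0 := by exact_mod_cast hl.ne'
  have hs : Real.sqrt 3 ≠ 0 := by positivity
  rw [tripletFactor]
  set v : ℤ × ℤ := (l * (s + 2 * r), 3 * l * s) with hv
  set x : ℝ × ℝ := (Real.sqrt 3 / (2 * ((3 * l : ℕ) : ℝ)), 1 / (2 * ((3 * l : ℕ) : ℝ))) with hx
  set y : ℝ × ℝ := (Real.sqrt 3 / ((3 * l : ℕ) : ℝ), 0) with hy
  have h3 : planeWave v x ^ 3 = 1 := by
    have : planeWave ((3 : ℤ) • v) x = 1 := by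
      rw [planeWave_eq_one_iff]
      refine ⟨2 * s + r, ?_⟩
      simp [hv, hx]
      field_simp
      ring
    rw [planeWave_zsmul_left] at this
    exact_mod_cast this
  have h2 : planeWave v y = planeWave v x ^ 2 := by
    have : planeWave v (x + x - y) = 1 := by
      rw [planeWave_eq_one_iff]
      refine ⟨s, ?_⟩
      simp [hv, hx, hy]
      field_simp
      ring
    rw [sq, ← planeWave_add, show x + x = (x + x - y) + y by abel, planeWave_add, this, one_mul]
  have h1 : planeWave v x ≠ 1 := by
    rw [Ne, planeWave_eq_one_iff]
    rintro ⟨n, hn⟩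
    apply h
    refine ⟨2 * n - s, ?_⟩
    have : (s + 2 * r : ℝ) = 3 * (2 * n - s) := by
      simp only [hv, hx] at hn
      push_cast at hn
      field_simp at hn
      linarith
    exact_mod_cast this
  rw [h2]
  have : (planeWave v x - 1) * (1 + planeWave v x + planeWave v x ^ 2) = 0 := by
    linear_combination h3
  exact (mul_eq_zero.1 this).resolve_left (sub_ne_zero.2 h1)

lemma IsBaseLattice.exists_even (hl : 0 < l) {X : ι → ℝ × ℝ} {t : ℝ × ℝ}
    (h : IsBaseLattice l X t) (v : ℤ × ℤ) (hT : tripletFactor l v ≠ 0) (hv : expSum X v ≠ 0) :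
    ∃ p q : ℤ, v = (p * (3 * l : ℕ), q * (3 * l : ℕ)) ∧ Even (p + q) := by
  obtain ⟨r, s, rfl⟩ := h.exists_of_expSum_ne_zero hl hv
  by_cases h3 : (3 : ℤ) ∣ s + 2 * r
  · obtain ⟨p, hp⟩ := h3
    refine ⟨p, s, ?_, ?_⟩
    · rw [hp]
      ext <;> push_cast <;> ring
    · exact ⟨2 * p - r, by linarith⟩
  · exact absurd (tripletFactor_eq_zero hl h3) hT

end BaseLattice

/-! ### Triplet configurations -/

section Triplets

variable {l : ℕ}

lemma two_mul_three_mul_sq (l : ℕ) : 2 * (3 * l) ^ 2 = 6 * l ^ 2 + 6 * l ^ 2 + 6 * l ^ 2 := by ring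

lemma two_mul_three_mul_sq_div (l : ℕ) : 2 * (3 * l) ^ 2 / 3 = 6 * l ^ 2 := by
  rw [two_mul_three_mul_sq]
  omega

/-- The first points of the triplets. -/
def firstPoints (x : Fin (2 * (3 * l) ^ 2) → ℝ × ℝ) (n : Fin (6 * l ^ 2)) : ℝ × ℝ :=
  x ⟨n, by have := n.2; have := two_mul_three_mul_sq l; omega⟩

lemma basePoints_eq (x : Fin (2 * (3 * l) ^ 2) → ℝ × ℝ) :
    basePoints (3 * l) x = periodize (Set.range (firstPoints x)) := by
  rw [basePoints, two_mul_three_mul_sq_div]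
  congr 1
  ext u
  constructor
  · rintro ⟨n, hn, rfl⟩
    exact ⟨⟨n, hn⟩, rfl⟩
  · rintro ⟨n, rfl⟩
    exact ⟨⟨n, _⟩, n.2, rfl⟩

/-- The three displacements within a triplet. -/
noncomputable def tripletShift (l : ℕ) : ℕ → ℝ × ℝ
  | 0 => 0
  | 1 => (Real.sqrt 3 / (2 * ((3 * l : ℕ) : ℝ)), 1 / (2 * ((3 * l : ℕ) : ℝ)))
  | _ => (Real.sqrt 3 / ((3 * l : ℕ) : ℝ), 0)

lemma IsTriplet.periodEq {x : Fin (2 * (3 * l) ^ 2) → ℝ × ℝ} (hx : IsTriplet (3 * l) x)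
    (n : Fin (6 * l ^ 2)) {s : ℕ} (hs : s < 3) (h : (n : ℕ) + s * (6 * l ^ 2) < 2 * (3 * l) ^ 2) :
    PeriodEq (x ⟨n + s * (6 * l ^ 2), h⟩) (firstPoints x n + tripletShift l s) := by
  have hn : (n : ℕ) < 2 * (3 * l) ^ 2 / 3 := by
    rw [two_mul_three_mul_sq_div]
    exact n.2
  have hn' : (n : ℕ) < 2 * (3 * l) ^ 2 := by omega
  have key := hx ⟨n, hn'⟩ ⟨n + s * (6 * l ^ 2), h⟩ hn
  simp only [two_mul_three_mul_sq_div] at key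
  interval_cases s
  · simpa [tripletShift, firstPoints] using PeriodEq.refl _
  · exact key.1 (by ring)
  · exact key.2 rfl

/-- The indices form three blocks of length `6l²`, each a translate of the first modulo the periods,
so the shift phases factor out. -/
lemma IsTriplet.expSum_eq {x : Fin (2 * (3 * l) ^ 2) → ℝ × ℝ} (hx : IsTriplet (3 * l) x)
    (v : ℤ × ℤ) : expSum x v = tripletFactor l v * expSum (firstPoints x) v := by
  have hN := two_mul_three_mul_sq l
  have hmem (s : ℕ) (hs : s < 3) (n : ℕ) (hn : n < 6 * l ^ 2) :
      n + s * (6 * l ^ 2) < 2 * (3 * l) ^ 2 := by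
    interval_cases s <;> omega
  set F : ℕ → ℂ := fun n => if h : n < 2 * (3 * l) ^ 2 then planeWave v (x ⟨n, h⟩) else 0 with hF
  have hF' (s : ℕ) (hs : s < 3) (n : Fin (6 * l ^ 2)) :
      F (n + s * (6 * l ^ 2)) = planeWave v (firstPoints x n) * planeWave v (tripletShift l s) := by
    rw [hF]
    simp only [dif_pos (hmem s hs n n.2)]
    rw [planeWave_congr (hx.periodEq n hs _), planeWave_add]
  have h1 : expSum x v = ∑ n ∈ Finset.range (2 * (3 * l) ^ 2), F n := by
    rw [Finset.sum_range, expSum]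
    exact Finset.sum_congr rfl fun n _ => by simp [hF]
  have hpart (s : ℕ) (hs : s < 3) : ∑ n ∈ Finset.range (6 * l ^ 2), F (n + s * (6 * l ^ 2))
      = planeWave v (tripletShift l s) * expSum (firstPoints x) v := by
    rw [Finset.sum_range, Finset.sum_congr rfl fun n _ => hF' s hs n, ← Finset.sum_mul, mul_comm,
      expSum]
  rw [h1, hN, Finset.sum_range_add, Finset.sum_range_add]
  have p0 := hpart 0 (by norm_num)
  have p1 := hpart 1 (by norm_num)
  have p2 := hpart 2 (by norm_num)
  simp only [zero_mul, add_zero] at p0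
  have e1 (n : ℕ) : 6 * l ^ 2 + n = n + 1 * (6 * l ^ 2) := by ring
  have e2 (n : ℕ) : 6 * l ^ 2 + 6 * l ^ 2 + n = n + 2 * (6 * l ^ 2) := by ring
  simp only [e2]
  simp only [e1]
  rw [p0, p1, p2]
  simp only [tripletShift, tripletFactor, planeWave_zero]
  ring

lemma pairEnergy_eq {N : ℕ} (f : ℝ × ℝ → ℝ) (x : Fin N → ℝ × ℝ) :
    pairEnergy f x = 1 / ((N : ℝ) * ((N : ℝ) - 1)) *
      ((∑ m, ∑ k, f (x m - x k)) - N * f 0) := by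
  have h (m k : Fin N) : (if m ≠ k then f (x m - x k) else 0)
      = f (x m - x k) - if m = k then f 0 else 0 := by
    by_cases hmk : m = k
    · simp [hmk]
    · simp [hmk]
  simp only [pairEnergy, h, Finset.sum_sub_distrib]
  simp

lemma pairEnergy_le_iff {N : ℕ} (hN : 1 < N) (f : ℝ × ℝ → ℝ) (x y : Fin N → ℝ × ℝ) :
    pairEnergy f x ≤ pairEnergy f y ↔
      ∑ m, ∑ k, f (x m - x k) ≤ ∑ m, ∑ k, f (y m - y k) := by
  have hN' : (1 : ℝ) < N := by exact_mod_cast hN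
  have hpos : 0 < 1 / ((N : ℝ) * ((N : ℝ) - 1)) :=
    one_div_pos.2 (mul_pos (by linarith) (by linarith))
  rw [pairEnergy_eq, pairEnergy_eq, mul_le_mul_iff_right₀ hpos, sub_le_sub_iff_right]

/-- The triangular lattice, listed as triplets over the base lattice. -/
noncomputable def latticeTriplets (l : ℕ) (n : Fin (2 * (3 * l) ^ 2)) : ℝ × ℝ :=
  baseLatticePoint l ((n % (6 * l ^ 2) / (3 * l) : ℕ) : ℤ) ((n % (6 * l ^ 2) % (3 * l) : ℕ) : ℤ)
    + tripletShift l (n / (6 * l ^ 2))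

lemma isTriplet_latticeTriplets (l : ℕ) : IsTriplet (3 * l) (latticeTriplets l) := by
  intro n k hn
  rw [two_mul_three_mul_sq_div] at hn ⊢
  have hpos : 0 < 6 * l ^ 2 := by omega
  have h0 : latticeTriplets l n = baseLatticePoint l ((n / (3 * l) : ℕ) : ℤ)
      ((n % (3 * l) : ℕ) : ℤ) := by
    rw [latticeTriplets, Nat.mod_eq_of_lt hn, Nat.div_eq_of_lt hn]
    simp [tripletShift]
  constructor
  · intro hk
    have h1 : (k : ℕ) % (6 * l ^ 2) = n := by
      rw [hk, Nat.add_mod_right, Nat.mod_eq_of_lt hn]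
    have h2 : (k : ℕ) / (6 * l ^ 2) = 1 := by
      rw [hk, Nat.add_div_right _ hpos, Nat.div_eq_of_lt hn]
    rw [h0, latticeTriplets, h1, h2]
    exact PeriodEq.refl _
  · intro hk
    have h1 : (k : ℕ) % (6 * l ^ 2) = n := by
      rw [hk, Nat.add_mul_mod_self_right, Nat.mod_eq_of_lt hn]
    have h2 : (k : ℕ) / (6 * l ^ 2) = 2 := by
      rw [hk, Nat.add_mul_div_right _ _ hpos, Nat.div_eq_of_lt hn]
    rw [h0, latticeTriplets, h1, h2]
    exact PeriodEq.refl _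

lemma isBaseLattice_firstPoints_latticeTriplets (hl : 0 < l) :
    IsBaseLattice l (firstPoints (latticeTriplets l)) 0 := by
  have hl3 : 0 < 3 * l := by omega
  have hM : 6 * l ^ 2 = 2 * l * (3 * l) := by ring
  refine ⟨(finCongr hM).trans finProdFinEquiv.symm, fun n => ?_⟩
  have hn := n.2
  have : firstPoints (latticeTriplets l) n = 0 + baseLatticePoint l
      ((((finCongr hM).trans finProdFinEquiv.symm n).1 : ℕ) : ℤ)
      ((((finCongr hM).trans finProdFinEquiv.symm n).2 : ℕ) : ℤ) := by
    simp [firstPoints, latticeTriplets, Nat.mod_eq_of_lt hn, Nat.div_eq_of_lt hn, tripletShift,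
      finProdFinEquiv]
  rw [this]
  exact PeriodEq.refl _

/-! ### The full triangular lattice -/

/-- The points of the triangular lattice in units of `√3/(6l)` and `1/(6l)`. -/
noncomputable def triangularPoint (l : ℕ) (c d : ℤ) : ℝ × ℝ :=
  (Real.sqrt 3 * c / (6 * l), d / (6 * l))

lemma triangularPoint_add (c d c' d' : ℤ) :
    triangularPoint l c d + triangularPoint l c' d' = triangularPoint l (c + c') (d + d') := by
  ext <;> simp only [triangularPoint, Prod.fst_add, Prod.snd_add] <;> push_cast <;> ring

lemma periodEq_triangularPoint_iff (hl : 0 < l) {u : ℝ × ℝ} {c d : ℤ} :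
    PeriodEq u (triangularPoint l c d) ↔
      ∃ i j : ℤ, u = triangularPoint l (c + 6 * l * i) (d + 6 * l * j) := by
  have hl' : (l : ℝ) ≠ 0 := by exact_mod_cast hl.ne'
  refine exists_congr fun i => exists_congr fun j => ?_
  have : triangularPoint l c d + (Real.sqrt 3 * (i : ℝ), (j : ℝ))
      = triangularPoint l (c + 6 * l * i) (d + 6 * l * j) := by
    ext <;> simp only [triangularPoint, Prod.fst_add, Prod.snd_add] <;> push_cast <;>
      field_simp
  rw [this]

lemma triangularLattice_eq (hl : 0 < l) :
    triangularLattice (3 * l) = {u | ∃ c d : ℤ, Even (c + d) ∧ u = triangularPoint l c d} := by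
  have hl' : (l : ℝ) ≠ 0 := by exact_mod_cast hl.ne'
  have hlz : (0 : ℤ) < l := by exact_mod_cast hl
  have hodd (k j : ℕ) : ((Real.sqrt 3 * ((k : ℝ) - 1) / ((3 * l : ℕ) : ℝ),
      ((j : ℝ) - 1) / (2 * ((3 * l : ℕ) : ℝ))) : ℝ × ℝ)
      = triangularPoint l (2 * (k - 1)) (j - 1) := by
    ext <;> simp only [triangularPoint] <;> push_cast <;> field_simp <;> ring
  have heven (k j : ℕ) : ((Real.sqrt 3 * ((k : ℝ) - 1 / 2) / ((3 * l : ℕ) : ℝ),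
      ((j : ℝ) - 1) / (2 * ((3 * l : ℕ) : ℝ))) : ℝ × ℝ)
      = triangularPoint l (2 * (k - 1) + 1) (j - 1) := by
    ext <;> simp only [triangularPoint] <;> push_cast <;> field_simp <;> ring
  ext u
  constructor
  · rintro ⟨w, ⟨k, j, -, -, ⟨⟨m, rfl⟩, rfl⟩ | ⟨⟨m, rfl⟩, rfl⟩⟩, hu⟩
    · rw [hodd, periodEq_triangularPoint_iff hl] at hu
      obtain ⟨i, j', rfl⟩ := hu
      exact ⟨_, _, ⟨k - 1 + m + 3 * l * i + 3 * l * j', by push_cast; ring⟩, rfl⟩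
    · rw [heven, periodEq_triangularPoint_iff hl] at hu
      obtain ⟨i, j', rfl⟩ := hu
      exact ⟨_, _, ⟨k - 1 + m + 3 * l * i + 3 * l * j', by push_cast; ring⟩, rfl⟩
  · rintro ⟨c, d, hcd, rfl⟩
    have h4 := Int.emod_add_mul_ediv d (6 * l)
    have h5 := Int.emod_nonneg d (show (6 * l : ℤ) ≠ 0 by positivity)
    have h6 := Int.emod_lt_of_pos d (show (0 : ℤ) < 6 * l by positivity)
    set j : ℕ := (d % (6 * l) + 1).toNat with hj
    have hjz : (j : ℤ) = d % (6 * l) + 1 := Int.toNat_of_nonneg (by linarith)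
    have hpar : ∃ z : ℤ, d - d % (6 * l) = 2 * z := ⟨3 * l * (d / (6 * l)), by linarith⟩
    have hk (c' : ℤ) : ∃ k : ℕ, (1 ≤ k ∧ k ≤ 3 * l) ∧
        c' = k - 1 + 3 * l * (c' / (3 * l)) := by
      have h1 := Int.emod_add_mul_ediv c' (3 * l)
      have h2 := Int.emod_nonneg c' (show (3 * l : ℤ) ≠ 0 by positivity)
      have h3 := Int.emod_lt_of_pos c' (show (0 : ℤ) < 3 * l by positivity)
      have hz : (((c' % (3 * l) + 1).toNat : ℕ) : ℤ) = c' % (3 * l) + 1 :=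
        Int.toNat_of_nonneg (by linarith)
      exact ⟨(c' % (3 * l) + 1).toNat, by omega, by rw [hz]; linarith⟩
    obtain ⟨c', rfl | rfl⟩ := Int.even_or_odd' c
    · obtain ⟨k, hkk, hkc⟩ := hk c'
      refine ⟨_, ⟨k, j, hkk, by omega, Or.inl ⟨?_, rfl⟩⟩, ?_⟩
      · rw [← Nat.not_even_iff_odd]
        grind
      · rw [hodd, periodEq_triangularPoint_iff hl]
        refine ⟨c' / (3 * l), d / (6 * l), ?_⟩
        congr 1 <;> linarith
    · obtain ⟨k, hkk, hkc⟩ := hk c'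
      refine ⟨_, ⟨k, j, hkk, by omega, Or.inr ⟨?_, rfl⟩⟩, ?_⟩
      · grind
      · rw [heven, periodEq_triangularPoint_iff hl]
        refine ⟨c' / (3 * l), d / (6 * l), ?_⟩
        congr 1 <;> linarith

lemma tripletShift_eq (hl : 0 < l) {s : ℕ} (hs : s < 3) :
    tripletShift l s = triangularPoint l s (if s = 1 then 1 else 0) := by
  have hl' : (l : ℝ) ≠ 0 := by exact_mod_cast hl.ne'
  interval_cases s <;> ext <;> simp [tripletShift, triangularPoint] <;> field_simp <;> norm_num

/-- In units of `√3/(6l)` and `1/(6l)`, the base lattice is `{(3a, 2b - a)}`, of index 3 in `{(c, d)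
: c + d even}`. The shifts `(0,0)`, `(1,1)`, `(2,0)` represent its cosets. -/
lemma periodize_range_eq_triangularLattice (hl : 0 < l) {x : Fin (2 * (3 * l) ^ 2) → ℝ × ℝ}
    (hx : IsTriplet (3 * l) x) {t : ℝ × ℝ}
    (h : basePoints (3 * l) x = translateSet t (latticeBase (3 * l))) :
    ∃ t, periodize (Set.range x) = translateSet t (triangularLattice (3 * l)) := by
  have hl' : (l : ℝ) ≠ 0 := by exact_mod_cast hl.ne'
  have hN := two_mul_three_mul_sq l
  have hpos : 0 < 6 * l ^ 2 := by positivity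
  rw [basePoints_eq, latticeBase_eq hl] at h
  -- The added vector is the offset of the base lattice from the origin of the triangular lattice.
  set t' : ℝ × ℝ := t + (-Real.sqrt 3 / (4 * (l : ℝ)), 1 / (6 * (l : ℝ))) with ht'
  have hpt (a b : ℤ) : t + baseLatticePoint l a b = t' + triangularPoint l (3 * a) (2 * b - a) := by
    rw [ht']
    ext <;> simp only [baseLatticePoint, triangularPoint, Prod.fst_add, Prod.snd_add] <;>
      push_cast <;> field_simp <;> ring
  refine ⟨t', ?_⟩
  rw [triangularLattice_eq hl]
  ext u
  constructor
  · rintro ⟨_, ⟨k, rfl⟩, hu⟩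
    have hs : (k : ℕ) / (6 * l ^ 2) < 3 := by
      rw [Nat.div_lt_iff_lt_mul hpos]
      have := k.2
      omega
    set s := (k : ℕ) / (6 * l ^ 2)
    have hk : (k : ℕ) = k % (6 * l ^ 2) + s * (6 * l ^ 2) := (Nat.mod_add_div' _ _).symm
    have hx1 := hx.periodEq ⟨k % (6 * l ^ 2), Nat.mod_lt _ hpos⟩ hs (hk ▸ k.2)
    have hke : (⟨k % (6 * l ^ 2) + s * (6 * l ^ 2), hk ▸ k.2⟩ : Fin (2 * (3 * l) ^ 2)) = k :=
      Fin.ext hk.symm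
    rw [hke] at hx1
    have hb : firstPoints x ⟨k % (6 * l ^ 2), Nat.mod_lt _ hpos⟩
        ∈ periodize (Set.range (firstPoints x)) := ⟨_, ⟨_, rfl⟩, PeriodEq.refl _⟩
    rw [h] at hb
    obtain ⟨_, ⟨a, b, rfl⟩, hab⟩ := hb
    simp only at hab
    rw [← hab, hpt, add_assoc, tripletShift_eq hl hs, triangularPoint_add] at hx1
    have h1 : PeriodEq (u - t')
        (triangularPoint l (3 * a + s) (2 * b - a + if s = 1 then 1 else 0)) :=
      PeriodEq.of_add_left (t := t') (by simpa using hu.trans hx1)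
    rw [periodEq_triangularPoint_iff hl] at h1
    obtain ⟨i, j, hij⟩ := h1
    refine ⟨u - t', ⟨_, _, ?_, hij⟩, by simp⟩
    have hev : Even ((s : ℤ) + if s = 1 then 1 else 0) := by
      clear_value s
      interval_cases s <;> decide
    obtain ⟨z, hz⟩ := hev
    exact ⟨a + b + z + 3 * l * i + 3 * l * j, by linarith⟩
  · rintro ⟨_, ⟨c, d, hcd, rfl⟩, rfl⟩
    -- The residue of `c` modulo 3 decides which member of the triplet sits at the point.
    obtain ⟨s, hs, a, ha⟩ : ∃ s : ℕ, s < 3 ∧ ∃ a : ℤ, c = 3 * a + s :=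
      ⟨(c % 3).toNat, by omega, c / 3, by omega⟩
    obtain ⟨b, hb⟩ : ∃ b : ℤ, d = 2 * b - a + if s = 1 then 1 else 0 := by
      obtain ⟨z, hz⟩ := hcd
      interval_cases s
      · exact ⟨z - a, by simp; omega⟩
      · exact ⟨z - a - 1, by simp; omega⟩
      · exact ⟨z - a - 1, by simp; omega⟩
    have hmem : t + baseLatticePoint l a b ∈ periodize (Set.range (firstPoints x)) := by
      rw [h]
      exact ⟨_, ⟨a, b, rfl⟩, rfl⟩
    obtain ⟨_, ⟨n, rfl⟩, hn⟩ := hmem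
    have hns : (n : ℕ) + s * (6 * l ^ 2) < 2 * (3 * l) ^ 2 := by
      have := n.2
      interval_cases s <;> omega
    refine ⟨_, ⟨⟨n + s * (6 * l ^ 2), hns⟩, rfl⟩, ?_⟩
    have h1 := (hn.add_right (tripletShift l s)).trans (hx.periodEq n hs hns).symm
    rw [hpt, add_assoc, tripletShift_eq hl hs, triangularPoint_add, ← ha, ← hb] at h1
    exact h1

end Triplets

/-! ### The main theorem -/

theorem theorem2 (f : ℝ × ℝ → ℝ) (a : ℤ × ℤ → ℝ)
    (hf : HasFourierExpansion f a) (ha : ∀ v : ℤ × ℤ, 0 < a v)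
    (lam : ℝ) (hlam : 0 < lam) (hsmall : ExpSmall a lam) (hlower : CoeffLowerBound a) :
    ∃ L₁ : ℕ, ∀ L : ℕ, L₁ ≤ L → 3 ∣ L → ∀ x : Fin (2 * L ^ 2) → ℝ × ℝ,
      (IsTripletMinimizer f L x ↔
        IsTriplet L x ∧ ∃ t : ℝ × ℝ, basePoints L x = translateSet t (latticeBase L)) ∧
      (IsTripletMinimizer f L x →
        ∃ t : ℝ × ℝ, periodize (Set.range x) = translateSet t (triangularLattice L)) := by
  obtain ⟨C, hC, L₀, hlow⟩ := hlower
  obtain ⟨l₁, hl₁⟩ := eventually_atTop.1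
    (((eventually_coefficient_pos ha hlam hsmall hC).and hsmall.1).and
      (eventually_gt_atTop L₀))
  refine ⟨3 * l₁ + 3, fun L hL ⟨l, hLl⟩ x => ?_⟩
  subst hLl
  have hl : 0 < l := by omega
  obtain ⟨⟨hcoef, hsum⟩, hlL⟩ := hl₁ l (by omega)
  have hlow' := hlow l (by omega)
  have hN : 1 < 2 * (3 * l) ^ 2 := by nlinarith
  have hcard : Fintype.card (Fin (6 * l ^ 2)) = 6 * l ^ 2 := Fintype.card_fin _
  have hE {z : Fin (2 * (3 * l) ^ 2) → ℝ × ℝ} (hz : IsTriplet (3 * l) z) :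
      HasSum (fun v => a v * (‖tripletFactor l v‖ ^ 2 * ‖expSum (firstPoints z) v‖ ^ 2))
        (∑ m, ∑ k, f (z m - z k)) := by
    convert hasSum_energy hf z using 3 with v
    rw [hz.expSum_eq, norm_mul, mul_pow]
  have hgap {y z : Fin (2 * (3 * l) ^ 2) → ℝ × ℝ} (hy : IsTriplet (3 * l) y)
      (hz : IsTriplet (3 * l) z) {t : ℝ × ℝ} (hzt : IsBaseLattice l (firstPoints z) t) :=
    energy_sub_ge hl hcard ha (hE hy) (hE hz) (hzt.exists_even hl) hsum hlow'
  have hbase (z : Fin (2 * (3 * l) ^ 2) → ℝ × ℝ) (t : ℝ × ℝ) :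
      basePoints (3 * l) z = translateSet t (latticeBase (3 * l)) ↔
        IsBaseLattice l (firstPoints z) t := by
    rw [basePoints_eq, periodize_range_eq_iff hl hcard]
  have hmin : IsTripletMinimizer f (3 * l) x → IsTriplet (3 * l) x ∧
      ∃ t : ℝ × ℝ, basePoints (3 * l) x = translateSet t (latticeBase (3 * l)) := by
    rintro ⟨hx, hxmin⟩
    refine ⟨hx, ?_⟩
    -- Comparison with one explicit lattice forces the visible intensity of a minimizer to vanish.
    have h1 := hgap hx (isTriplet_latticeTriplets l) (isBaseLattice_firstPoints_latticeTriplets hl)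
    have h2 := (pairEnergy_le_iff hN f _ _).1 (hxmin _ (isTriplet_latticeTriplets l))
    have h3 : visibleIntensity l (firstPoints x) = 0 := by
      by_contra hne
      have := mul_pos ((visibleIntensity_nonneg (l := l) (firstPoints x)).lt_of_ne' hne)
        (sub_pos.2 hcoef)
      linarith
    obtain ⟨t, ht⟩ := isBaseLattice_of_visibleIntensity_eq_zero hl hcard h3
    exact ⟨t, (hbase x t).2 ht⟩
  refine ⟨⟨hmin, ?_⟩, fun h => ?_⟩
  · rintro ⟨hx, t, ht⟩
    refine ⟨hx, fun y hy => (pairEnergy_le_iff hN f _ _).2 ?_⟩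
    -- The gap estimate holds against any translate or relabeling of the base lattice, so `x` itself
    -- serves as the reference configuration.
    have h1 := hgap hy hx ((hbase x t).1 ht)
    have := mul_nonneg (visibleIntensity_nonneg (l := l) (firstPoints y)) (sub_pos.2 hcoef).le
    linarith
  · obtain ⟨hx, t, ht⟩ := hmin h
    exact periodize_range_eq_triangularLattice hl hx ht
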